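/- Let $0=x_0<x_1<\dots<x_N=1$ and let $T:[0,1]\to[0,1]$ be a piecewise affine, expanding, transitive Markov map with the $N$ atoms $I_i=(x_{i-1},x_i)$, $1\le i\le N$. That is: on each $I_i$ the map $T$ is affine with slope of modulus larger than $1$; whenever $T(I_i)$ meets $I_j$, it contains $I_j$; and the $N\times N$ transition matrix $M$, with $M_{ij}=1$ if $T(I_i)\supset I_j$ and $M_{ij}=0$ otherwise, is irreducible. (The values of $T$ at the points $x_i$ are arbitrary.) Let $h_{\mathrm{top}}(T)$ be the topological entropy of $T$ (the supremum over $\varepsilon>0$ of the exponential growth rate in $n$ of the minimal number of $(n,\varepsilon)$-dynamical balls that cover $[0,1]$). For $0<\gamma<1$ let $\phi_\gamma:[0,1]\to\mathbb{R}$, $\phi_\gamma(x)=\sum_{k=0}^{\infty}\gamma^kT^{k+1}(x)$, where $T^{k+1}$ is the $(k+1)$-st iterate of $T$. Then: 1. for every $\gamma\in(0,1)$ with $e^{h_{\mathrm{top}}(T)}\gamma<1$, the total variation of $\phi_\gamma$ on $[0,1]$ is finite; 2. the total variation of $\phi_\gamma$ on $[0,1]$ is infinite for every $\gamma\in(0,1)$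 with $e^{h_{\mathrm{top}}(T)}\gamma>1$, except possibly for at most $2N-1$ values of $\gamma$. -/

import Mathlib

/-- The topological entropy of a (not necessarily continuous) self-map of `[0, 1]`, in the sense of
Bowen and Dinaburg: the supremum over scales `ε` of the exponential growth rate in `n` of the minimal
number of `(n, ε)`-dynamical balls that cover `[0, 1]`. -/
noncomputable def topEntropy (T : unitInterval → unitInterval) : EReal :=
  Dynamics.coverEntropy T Set.univ

/-- The (open) atoms `(x_i, x_{i+1})` cut out by the points `x_0, …, x_N`. -/
def atom {N : ℕ} (x : Fin (N + 1) → unitInterval) (i : Fin N) : Set unitInterval :=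
  Set.Ioo (x i.castSucc) (x i.succ)

/-- `T` is a piecewise affine, expanding Markov map of `[0, 1]` with respect to the subdivision
`0 = x_0 < x_1 < ⋯ < x_N = 1`: on each open atom it is affine with a slope of modulus larger
than one, and the image of an atom contains every atom that it meets. The values of `T` at the points
`x_i` are arbitrary. -/
structure IsAffineExpandingMarkov {N : ℕ} (T : unitInterval → unitInterval)
    (x : Fin (N + 1) → unitInterval) : Prop where
  first : x 0 = 0
  last : x (Fin.last N) = 1
  strictMono : StrictMono x
  affine_expanding : ∀ i : Fin N, ∃ s t : ℝ, 1 < |s| ∧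
    ∀ y ∈ atom x i, ((T y : unitInterval) : ℝ) = s * (y : ℝ) + t
  markov : ∀ i j : Fin N, (T '' atom x i ∩ atom x j).Nonempty → atom x j ⊆ T '' atom x i

open Classical in
/-- The transition matrix: the entry `(i, j)` is `1` if the image of atom `i` contains atom `j`,
and `0` otherwise. -/
noncomputable def transitionMatrix {N : ℕ} (T : unitInterval → unitInterval)
    (x : Fin (N + 1) → unitInterval) : Matrix (Fin N) (Fin N) ℝ :=
  fun i j => if atom x j ⊆ T '' atom x i then 1 else 0

/-- The sync function `φ_γ = ∑_{k ≥ 0} γ^k T^{k+1}`. The series converges for `|γ| < 1`, as the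
iterates of `T` take values in `[0, 1]`. -/
noncomputable def syncFun (T : unitInterval → unitInterval) (γ : ℝ) (y : unitInterval) : ℝ :=
  ∑' k : ℕ, γ ^ k * ((T^[k + 1] y : unitInterval) : ℝ)

/-! Everything is compared with the number of walks of length `n` in the transition graph
(`walkCount`), whose exponential growth rate is the entropy. The two estimates needed are
`exp_topEntropy_mul_le_one`, which covers by pulling nets back along walks, and
`walkCount_le_of_topEntropy_lt`, where a small dynamical ball sees few itineraries.

Finite variation: the variation of `T^[n]` is at most a polynomial in `n` times the number of walks,
and the variation of `φ_γ` is at most `∑ γ^k Var(T^{k+1})`, which converges when `e^h γ < 1`.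

Infinite variation: `φ_γ = T + γ φ_γ ∘ T`, and `T` is affine on atoms. Let `W i` be the infimum of
the variations of `φ_γ + a y` on atom `i` over real `a`. The equation gives `W i ≥ γ ∑ W j` over the
successors `j` of `i` (`variationModAffine_syncFun_ge`). If `φ_γ` has finite variation, either all
`W i` are positive, the walk counts are `O(γ^{-n})` and `e^h γ ≤ 1`; or some `W i` vanishes, hence
all do by irreducibility, and `φ_γ` is affine on each atom.

The affine case is rare. Each edge of the graph ties the coefficients of `φ_γ` on its two atoms, so
a closed walk determines those at its base as rational functions of `γ`. Two closed walks of length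
at most `N` from one atom with different affine data (`exists_distinct_closedWalks`) must give equal
values, so `γ` is a root of a polynomial of degree at most `2N - 1`. It is nonzero because the power
series of these rational functions recover the data of the walks. -/

/-! ### Affine solutions along a walk -/

open Polynomial in
/-- The polynomial `∑_{m < n} (σ k ⋯ σ (k + m)) X ^ m`. -/
noncomputable def slopePoly (σ : ℕ → ℝ) (k n : ℕ) : ℝ[X] :=
  ∑ m ∈ Finset.range n, C (∏ l ∈ Finset.range (m + 1), σ (k + l)) * X ^ m

open Polynomial in
/-- The polynomial `∑_{k < n} (τ k / σ k) X ^ k * slopePoly σ k g`. -/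
noncomputable def translationPoly (σ τ : ℕ → ℝ) (g n : ℕ) : ℝ[X] :=
  ∑ k ∈ Finset.range n, C (τ k / σ k) * X ^ k * slopePoly σ k g

/-- Along a walk with slopes `σ` and translations `τ`, the sequences `a` and `b` are the
coefficients of affine functions `ℓ_k` with `ℓ_k = T_k + x * ℓ_{k+1} ∘ T_k`, where
`T_k(y) = σ k * y + τ k`. -/
structure IsAffineSolution {K : Type*} [CommRing K] [Algebra ℝ K] (x : K) (σ τ : ℕ → ℝ)
    (a b : ℕ → K) : Prop where
  slope : ∀ k, a k = algebraMap ℝ K (σ k) * (1 + x * a (k + 1))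
  trans : ∀ k, b k = algebraMap ℝ K (τ k) * (1 + x * a (k + 1)) + x * b (k + 1)

namespace IsAffineSolution

variable {K : Type*} [CommRing K] [Algebra ℝ K] {x : K} {σ τ : ℕ → ℝ} {a b : ℕ → K}

open Polynomial in
theorem slope_expansion (h : IsAffineSolution x σ τ a b) (k n : ℕ) :
    a k = aeval x (slopePoly σ k n) +
      algebraMap ℝ K (∏ l ∈ Finset.range n, σ (k + l)) * x ^ n * a (k + n) := by
  induction n with
  | zero => simp [slopePoly]
  | succ n ih =>
    rw [ih]
    conv_lhs => rw [h.slope (k + n)]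
    simp only [slopePoly, Finset.sum_range_succ, map_add, map_mul, aeval_C, map_pow, aeval_X,
      Finset.prod_range_succ, add_assoc]
    ring

theorem _root_.Function.Periodic.prod_window_eq {σ : ℕ → ℝ} {g : ℕ} (hσ : Function.Periodic σ g)
    (h0 : ∀ k, σ k ≠ 0) (k : ℕ) :
    ∏ l ∈ Finset.range g, σ (k + l) = ∏ l ∈ Finset.range g, σ l := by
  induction k with
  | zero => simp
  | succ k ih =>
    rw [← ih]
    have h1 := Finset.prod_range_succ (fun l => σ (k + l)) g
    have h2 := Finset.prod_range_succ' (fun l => σ (k + l)) g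
    rw [h1] at h2
    simp only [add_zero, hσ k] at h2
    have h3 := mul_right_cancel₀ (h0 k) h2
    rw [h3]
    exact Finset.prod_congr rfl fun l _ => by congr 1; ring

-- After one period the expansion returns to `a k` itself. The denominator stays on the left, so the
-- identity also holds at its zeros and over power series.
open Polynomial in
theorem slope_closed (h : IsAffineSolution x σ τ a b) {g : ℕ} (h0 : ∀ k, σ k ≠ 0)
    (hσ : Function.Periodic σ g) (ha : Function.Periodic a g) (k : ℕ) :
    aeval x (1 - C (∏ l ∈ Finset.range g, σ l) * X ^ g : ℝ[X]) * a k =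
      aeval x (slopePoly σ k g) := by
  have h1 := h.slope_expansion k g
  rw [hσ.prod_window_eq h0 k, ha k] at h1
  simp only [map_sub, map_one, map_mul, aeval_C, map_pow, aeval_X]
  linear_combination h1

/-- The slope relation turns `τ k * (1 + x * a (k + 1))` into `(τ k / σ k) * a k`; this is where the
quotients in `translationPoly` come from. -/
theorem trans_expansion (h : IsAffineSolution x σ τ a b) (h0 : ∀ k, σ k ≠ 0) (n : ℕ) :
    b 0 = ∑ k ∈ Finset.range n, algebraMap ℝ K (τ k / σ k) * x ^ k * a k + x ^ n * b n := by
  induction n with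
  | zero => simp
  | succ n ih =>
    rw [ih, Finset.sum_range_succ]
    have h1 : algebraMap ℝ K (τ n / σ n) * a n =
        algebraMap ℝ K (τ n) * (1 + x * a (n + 1)) := by
      rw [h.slope n, ← mul_assoc, ← map_mul, div_mul_cancel₀ _ (h0 n)]
    rw [h.trans n, ← h1]
    ring

-- The slope period `g` is kept apart from the return time `L`: two walks with equal slopes can then
-- share the first factor.
open Polynomial in
theorem trans_closed (h : IsAffineSolution x σ τ a b) {g L : ℕ} (h0 : ∀ k, σ k ≠ 0)
    (hσ : Function.Periodic σ g) (ha : Function.Periodic a g) (hb : b L = b 0) :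
    aeval x (1 - C (∏ l ∈ Finset.range g, σ l) * X ^ g : ℝ[X]) * (1 - x ^ L) * b 0 =
      aeval x (translationPoly σ τ g L) := by
  have h1 := h.trans_expansion h0 L
  rw [hb] at h1
  have h2 : (1 - x ^ L) * b 0 =
      ∑ k ∈ Finset.range L, algebraMap ℝ K (τ k / σ k) * x ^ k * a k := by
    linear_combination h1
  rw [mul_assoc, h2, translationPoly, map_sum, Finset.mul_sum]
  refine Finset.sum_congr rfl fun k _ => ?_
  rw [map_mul, ← h.slope_closed h0 hσ ha k]
  simp only [map_mul, aeval_C, map_pow, aeval_X]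
  ring

end IsAffineSolution

/-! ### Formal power series solutions -/

open PowerSeries in
/-- The formal slope coefficients along a walk. -/
noncomputable def formalSlope (σ : ℕ → ℝ) (k : ℕ) : ℝ⟦X⟧ :=
  PowerSeries.mk fun n => ∏ l ∈ Finset.range (n + 1), σ (k + l)

/-- The constant term of the composition of `n + 1` consecutive affine maps along a walk. -/
noncomputable def composedTrans (σ τ : ℕ → ℝ) : ℕ → ℕ → ℝ
  | 0, k => τ k
  | n + 1, k => τ k * ∏ l ∈ Finset.range (n + 1), σ (k + 1 + l) + composedTrans σ τ n (k + 1)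

open PowerSeries in
/-- The formal translation coefficients along a walk. -/
noncomputable def formalTrans (σ τ : ℕ → ℝ) (k : ℕ) : ℝ⟦X⟧ :=
  PowerSeries.mk fun n => composedTrans σ τ n k

/-- Formally `ℓ_k = ∑ X^n T_{k+n} ∘ ⋯ ∘ T_k`. This solution with `X` as parameter serves to show
that the polynomials below are nonzero. -/
theorem isAffineSolution_formal (σ τ : ℕ → ℝ) :
    IsAffineSolution (PowerSeries.X : PowerSeries ℝ) σ τ (formalSlope σ) (formalTrans σ τ) where
  slope k := by
    ext n
    rw [PowerSeries.algebraMap_apply, Algebra.algebraMap_self, RingHom.id_apply,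
      PowerSeries.coeff_C_mul]
    cases n with
    | zero => simp [formalSlope]
    | succ n =>
      rw [map_add, PowerSeries.coeff_succ_X_mul, formalSlope, formalSlope, PowerSeries.coeff_mk,
        PowerSeries.coeff_mk, Finset.prod_range_succ', PowerSeries.coeff_one]
      simp only [add_zero, Nat.add_eq_zero_iff, one_ne_zero, and_false, if_false, zero_add]
      rw [mul_comm]
      congr 1
      exact Finset.prod_congr rfl fun l _ => by congr 1; ring
  trans k := by
    ext n
    rw [PowerSeries.algebraMap_apply, Algebra.algebraMap_self, RingHom.id_apply, map_add,
      PowerSeries.coeff_C_mul]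
    cases n with
    | zero => simp [formalTrans, composedTrans]
    | succ n =>
      rw [map_add, PowerSeries.coeff_succ_X_mul, PowerSeries.coeff_succ_X_mul, formalSlope,
        formalTrans, formalTrans, PowerSeries.coeff_mk, PowerSeries.coeff_mk,
        PowerSeries.coeff_mk, PowerSeries.coeff_one]
      simp [composedTrans]

theorem Function.Periodic.formalSlope {σ : ℕ → ℝ} {L : ℕ} (hσ : Function.Periodic σ L) :
    Function.Periodic (formalSlope σ) L := by
  intro k
  ext n
  simp only [_root_.formalSlope, PowerSeries.coeff_mk]
  refine Finset.prod_congr rfl fun l _ => ?_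
  rw [← hσ (k + l)]
  congr 1; ring

theorem formalTrans_periodic {σ τ : ℕ → ℝ} {L : ℕ} (hσ : Function.Periodic σ L)
    (hτ : Function.Periodic τ L) : Function.Periodic (formalTrans σ τ) L := by
  intro k
  ext n
  simp only [formalTrans, PowerSeries.coeff_mk]
  induction n generalizing k with
  | zero => exact hτ k
  | succ n ih =>
    simp only [composedTrans, hτ k]
    rw [← ih (k + 1), add_right_comm k L 1]
    congr 2
    refine Finset.prod_congr rfl fun l _ => ?_
    rw [← hσ (k + 1 + l)]
    congr 1; ring

theorem slope_eq_of_formalSlope_eq {σ σ' : ℕ → ℝ} (h0 : ∀ k, σ k ≠ 0)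
    (h : formalSlope σ 0 = formalSlope σ' 0) : σ = σ' := by
  have h1 : ∀ n, ∏ l ∈ Finset.range n, σ l = ∏ l ∈ Finset.range n, σ' l := by
    intro n
    cases n with
    | zero => simp
    | succ n => simpa [formalSlope] using congrArg (PowerSeries.coeff n) h
  funext n
  have h2 := h1 (n + 1)
  rw [Finset.prod_range_succ, Finset.prod_range_succ, ← h1 n] at h2
  exact mul_left_cancel₀ (Finset.prod_ne_zero_iff.2 fun l _ => h0 l) h2

/-- The coefficient of index 0 gives `τ k`; removing its contribution from the others leaves the
same problem at `k + 1`. -/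
theorem trans_eq_of_formalTrans_eq {σ τ τ' : ℕ → ℝ}
    (h : formalTrans σ τ 0 = formalTrans σ τ' 0) : τ = τ' := by
  have h1 : ∀ k n, composedTrans σ τ n k = composedTrans σ τ' n k := by
    intro k
    induction k with
    | zero => intro n; simpa [formalTrans] using congrArg (PowerSeries.coeff n) h
    | succ k ih =>
      intro n
      have h2 := ih (n + 1)
      have h3 := ih 0
      simp only [composedTrans] at h2 h3
      rw [h3] at h2
      exact add_left_cancel h2
  funext k
  exact h1 k 0

/-! ### Polynomials that detect a coincidence of two closed walks -/

open Polynomial in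
theorem natDegree_slopePoly_le (σ : ℕ → ℝ) (k : ℕ) {n : ℕ} (hn : 1 ≤ n) :
    (slopePoly σ k n).natDegree ≤ n - 1 := by
  refine natDegree_sum_le_of_forall_le _ _ fun m hm => ?_
  rw [Finset.mem_range] at hm
  exact (natDegree_C_mul_X_pow_le _ _).trans (by omega)

open Polynomial in
theorem natDegree_translationPoly_le (σ τ : ℕ → ℝ) {g n : ℕ} (hg : 1 ≤ g) (hn : 1 ≤ n) :
    (translationPoly σ τ g n).natDegree ≤ (n - 1) + (g - 1) := by
  refine natDegree_sum_le_of_forall_le _ _ fun m hm => ?_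
  rw [Finset.mem_range] at hm
  refine natDegree_mul_le.trans (add_le_add ?_ (natDegree_slopePoly_le σ m hg))
  exact (natDegree_C_mul_X_pow_le _ _).trans (by omega)

open Polynomial in
theorem one_sub_C_mul_X_pow_ne_zero (r : ℝ) {n : ℕ} (hn : 1 ≤ n) :
    (1 - C r * X ^ n : ℝ[X]) ≠ 0 := by
  intro h
  have := congrArg (eval 0) h
  simp [show n ≠ 0 by omega] at this

open Polynomial in
theorem powerSeries_aeval_X_injective {P : ℝ[X]}
    (h : aeval (PowerSeries.X : PowerSeries ℝ) P = 0) : P = 0 := by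
  have h1 : (aeval (PowerSeries.X : PowerSeries ℝ) P) = (P : PowerSeries ℝ) := by
    clear h
    induction P using Polynomial.induction_on' with
    | add p q hp hq => rw [map_add, hp, hq, Polynomial.coe_add]
    | monomial n r =>
      rw [aeval_monomial, Polynomial.coe_monomial, PowerSeries.X_pow_eq,
        PowerSeries.algebraMap_apply, Algebra.algebraMap_self, RingHom.id_apply]
      ext m
      rw [PowerSeries.coeff_C_mul, PowerSeries.coeff_monomial, PowerSeries.coeff_monomial]
      split <;> simp
  rw [h1] at h
  exact_mod_cast h

open Polynomial in
/-- If two closed walks have different slope sequences, a nonzero polynomial of small degree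
vanishes at every parameter at which the two walks have affine solutions with the same initial
slope. -/
theorem exists_polynomial_of_slope_ne {N L L' : ℕ} (hL : 1 ≤ L) (hL' : 1 ≤ L') (hLN : L ≤ N)
    (hLN' : L' ≤ N) {σ σ' τ τ' : ℕ → ℝ} (h0 : ∀ k, σ k ≠ 0) (h0' : ∀ k, σ' k ≠ 0)
    (hσ : Function.Periodic σ L) (hσ' : Function.Periodic σ' L') (hne : σ ≠ σ') :
    ∃ Q : ℝ[X], Q ≠ 0 ∧ Q.natDegree ≤ 2 * N - 1 ∧ ∀ (γ : ℝ) (a b a' b' : ℕ → ℝ),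
      IsAffineSolution γ σ τ a b → IsAffineSolution γ σ' τ' a' b' → Function.Periodic a L →
      Function.Periodic a' L' → a 0 = a' 0 → Q.eval γ = 0 := by
  set D : ℝ[X] := 1 - C (∏ l ∈ Finset.range L, σ l) * X ^ L with hD
  set D' : ℝ[X] := 1 - C (∏ l ∈ Finset.range L', σ' l) * X ^ L' with hD'
  have degD : ∀ (r : ℝ) (n : ℕ), (1 - C r * X ^ n : ℝ[X]).natDegree ≤ n := fun r n =>
    (natDegree_sub_le _ _).trans (max_le (by simp) (natDegree_C_mul_X_pow_le _ _))
  -- The initial slopes are the fractions `slopePoly σ 0 L / D` and `slopePoly σ' 0 L' / D'`; this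
  -- is the numerator of their difference, of degree at most `L + L' - 1`.
  refine ⟨slopePoly σ 0 L * D' - slopePoly σ' 0 L' * D, fun hQ => hne ?_, ?_, ?_⟩
  · have h1 := (isAffineSolution_formal σ τ).slope_closed h0 hσ hσ.formalSlope 0
    have h2 := (isAffineSolution_formal σ' τ').slope_closed h0' hσ' hσ'.formalSlope 0
    have h3 := congrArg (aeval (PowerSeries.X : PowerSeries ℝ)) hQ
    rw [map_sub, map_mul, map_mul, ← h1, ← h2, map_zero] at h3
    have hDne : aeval (PowerSeries.X : PowerSeries ℝ) D ≠ 0 := fun h =>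
      one_sub_C_mul_X_pow_ne_zero _ hL (powerSeries_aeval_X_injective h)
    have hDne' : aeval (PowerSeries.X : PowerSeries ℝ) D' ≠ 0 := fun h =>
      one_sub_C_mul_X_pow_ne_zero _ hL' (powerSeries_aeval_X_injective h)
    refine slope_eq_of_formalSlope_eq h0 ?_
    refine mul_left_cancel₀ (mul_ne_zero hDne hDne') ?_
    linear_combination h3
  · refine (natDegree_sub_le _ _).trans (max_le ?_ ?_)
    · refine natDegree_mul_le.trans
        ((add_le_add (natDegree_slopePoly_le σ 0 hL) (degD _ _)).trans ?_)
      omega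
    · refine natDegree_mul_le.trans
        ((add_le_add (natDegree_slopePoly_le σ' 0 hL') (degD _ _)).trans ?_)
      omega
  · intro γ a b a' b' h h' ha ha' haa
    have h1 := h.slope_closed h0 hσ ha 0
    have h2 := h'.slope_closed h0' hσ' ha' 0
    simp only [coe_aeval_eq_eval] at h1 h2
    rw [eval_sub, eval_mul, eval_mul, ← h1, ← h2, haa]
    ring

/-- A period of `f` is a period of the point `f` under the shift of sequences. -/
theorem Function.Periodic.gcd_nat {α : Type*} {f : ℕ → α} {m n : ℕ} (hm : Function.Periodic f m)
    (hn : Function.Periodic f n) : Function.Periodic f (m.gcd n) := by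
  let S : (ℕ → α) → ℕ → α := fun u k => u (k + 1)
  have hS : ∀ j (u : ℕ → α), S^[j] u = fun k => u (k + j) := by
    intro j
    induction j with
    | zero => intro u; simp
    | succ j ih =>
      intro u
      rw [Function.iterate_succ_apply, ih]
      funext k
      simp only [S]
      congr 1
  have key : ∀ j, Function.Periodic f j ↔ Function.IsPeriodicPt S j f := by
    intro j
    rw [Function.IsPeriodicPt, Function.IsFixedPt, hS, funext_iff]
    rfl
  exact (key _).2 (((key _).1 hm).gcd ((key _).1 hn))

open Polynomial in
/-- If two closed walks have the same slope sequence and different translation sequences, a nonzero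
polynomial of small degree vanishes at every parameter in `(0, 1)` at which the two walks have affine
solutions with the same initial affine function. -/
theorem exists_polynomial_of_trans_ne {N L L' : ℕ} (hL : 1 ≤ L) (hL' : 1 ≤ L') (hLN : L ≤ N)
    (hLN' : L' ≤ N) {σ τ τ' : ℕ → ℝ} (h0 : ∀ k, σ k ≠ 0)
    (hσ : Function.Periodic σ L) (hσ' : Function.Periodic σ L') (hτ : Function.Periodic τ L)
    (hτ' : Function.Periodic τ' L') (hne : τ ≠ τ') :
    ∃ Q : ℝ[X], Q ≠ 0 ∧ Q.natDegree ≤ 2 * N - 1 ∧ ∀ (γ : ℝ) (a b a' b' : ℕ → ℝ), 0 < γ → γ < 1 →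
      IsAffineSolution γ σ τ a b → IsAffineSolution γ σ τ' a' b' → Function.Periodic a L →
      Function.Periodic a' L' → b L = b 0 → b' L' = b' 0 → a 0 = a' 0 → b 0 = b' 0 →
      Q.eval γ = 0 := by
  set g := L.gcd L' with hg
  have hg1 : 1 ≤ g := Nat.gcd_pos_of_pos_left _ hL
  obtain ⟨m, hm⟩ : g ∣ L := Nat.gcd_dvd_left L L'
  obtain ⟨m', hm'⟩ : g ∣ L' := Nat.gcd_dvd_right L L'
  have hσg : Function.Periodic σ g := hσ.gcd_nat hσ'
  set D : ℝ[X] := 1 - C (∏ l ∈ Finset.range g, σ l) * X ^ g with hD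
  let G : ℕ → ℝ[X] := fun n => ∑ k ∈ Finset.range n, (X ^ g) ^ k
  have hG : ∀ n, (1 - X ^ g) * G n = 1 - X ^ (g * n) := fun n => by
    rw [mul_neg_geom_sum, ← pow_mul]
  have degG : ∀ n, (G n).natDegree ≤ g * n - g := fun n => by
    refine natDegree_sum_le_of_forall_le _ _ fun k hk => ?_
    rw [Finset.mem_range] at hk
    rw [← pow_mul, natDegree_X_pow]
    refine Nat.le_sub_of_add_le ?_
    calc g * k + g = g * (k + 1) := by ring
      _ ≤ g * n := Nat.mul_le_mul_left _ hk
  -- Cross-multiplying the two fractions for the initial translation, with the common factors `D`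
  -- and `1 - X ^ g` cancelled. Without the second cancellation the degree could exceed `2 * N - 1`;
  -- with it, the degree is at most `L + L' - 2`.
  refine ⟨translationPoly σ τ g L * G m' - translationPoly σ τ' g L' * G m, fun hQ => hne ?_, ?_, ?_⟩
  · have h1 := (isAffineSolution_formal σ τ).trans_closed h0 hσg hσg.formalSlope
      (by simpa using formalTrans_periodic hσ hτ 0)
    have h2 := (isAffineSolution_formal σ τ').trans_closed h0 hσg hσg.formalSlope
      (by simpa using formalTrans_periodic hσ' hτ' 0)
    have hQ' : translationPoly σ τ g L * (1 - X ^ L') - translationPoly σ τ' g L' * (1 - X ^ L) = 0 := by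
      rw [hm, hm', ← hG m, ← hG m', ← hm, ← hm']
      linear_combination (1 - X ^ g) * hQ
    have h3 := congrArg (aeval (PowerSeries.X : PowerSeries ℝ)) hQ'
    rw [map_sub, map_mul, map_mul, ← h1, ← h2, map_zero] at h3
    have hDne : aeval (PowerSeries.X : PowerSeries ℝ) D ≠ 0 := fun h =>
      one_sub_C_mul_X_pow_ne_zero _ hg1 (powerSeries_aeval_X_injective h)
    have hX : ∀ n : ℕ, 1 ≤ n → (1 - PowerSeries.X ^ n : PowerSeries ℝ) ≠ 0 := fun n hn h =>
      one_sub_C_mul_X_pow_ne_zero 1 hn (powerSeries_aeval_X_injective (by simpa using h))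
    refine trans_eq_of_formalTrans_eq (σ := σ) ?_
    refine mul_left_cancel₀ (mul_ne_zero hDne (mul_ne_zero (hX L hL) (hX L' hL'))) ?_
    simp only [map_sub, map_one, map_pow, aeval_X] at h3
    simp only [D, map_sub, map_one]
    linear_combination h3
  · have hgL : g ≤ L := Nat.le_of_dvd hL ⟨m, hm⟩
    have hgL' : g ≤ L' := Nat.le_of_dvd hL' ⟨m', hm'⟩
    refine (natDegree_sub_le _ _).trans (max_le ?_ ?_)
    · refine natDegree_mul_le.trans
        ((add_le_add (natDegree_translationPoly_le σ τ hg1 hL) (degG _)).trans ?_)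
      rw [← hm']; omega
    · refine natDegree_mul_le.trans
        ((add_le_add (natDegree_translationPoly_le σ τ' hg1 hL') (degG _)).trans ?_)
      rw [← hm]; omega
  · intro γ a b a' b' hγ0 hγ1 h h' ha ha' hb hb' haa hbb
    -- As `γ` and the slopes are nonzero, the slope relation determines `a (k + 1)` from `a k`. So
    -- `a` inherits both periods, hence their gcd.
    have haeq : a = a' := by
      funext k
      induction k with
      | zero => exact haa
      | succ k ih =>
        have h1 := h.slope k
        have h2 := h'.slope k
        rw [ih, h2] at h1
        have h3 := mul_left_cancel₀ (a := (algebraMap ℝ ℝ) (σ k)) (by simpa using h0 k) h1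
        exact (mul_left_cancel₀ hγ0.ne' (add_left_cancel h3)).symm
    subst haeq
    have hag : Function.Periodic a g := ha.gcd_nat ha'
    have h1 := h.trans_closed h0 hσg hag hb
    have h2 := h'.trans_closed h0 hσg hag hb'
    rw [hbb] at h1
    have e : ∀ n, (1 - γ ^ g) * (G n).eval γ = 1 - γ ^ (g * n) := fun n => by
      simpa using congrArg (eval γ) (hG n)
    have hγg : (1 - γ ^ g) ≠ 0 := by
      have := pow_lt_one₀ hγ0.le hγ1 (show g ≠ 0 by omega)
      linarith
    refine mul_left_cancel₀ hγg ?_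
    simp only [coe_aeval_eq_eval] at h1 h2
    have e1 := e m
    have e2 := e m'
    rw [← hm] at e1
    rw [← hm'] at e2
    rw [eval_sub, eval_mul, eval_mul, ← h1, ← h2]
    linear_combination (eval γ (1 - C (∏ l ∈ Finset.range g, σ l) * X ^ g : ℝ[X])) * b' 0 *
      ((1 - γ ^ L) * e2 - (1 - γ ^ L') * e1)

/-! ### The transition graph and the regular points -/

open Classical in
/-- The atoms contained in the image of the atom `i`. -/
noncomputable def successors {N : ℕ} (T : unitInterval → unitInterval)
    (x : Fin (N + 1) → unitInterval) (i : Fin N) : Finset (Fin N) :=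
  Finset.univ.filter fun j => atom x j ⊆ T '' atom x i

theorem mem_successors {N : ℕ} {T : unitInterval → unitInterval}
    {x : Fin (N + 1) → unitInterval} {i j : Fin N} :
    j ∈ successors T x i ↔ atom x j ⊆ T '' atom x i := by
  simp [successors]

/-- The number of walks with `n` steps in the transition graph that start at `i`. -/
noncomputable def walkCount {N : ℕ} (T : unitInterval → unitInterval)
    (x : Fin (N + 1) → unitInterval) : ℕ → Fin N → ℕ
  | 0, _ => 1
  | n + 1, i => ∑ j ∈ successors T x i, walkCount T x n j

/-- The points whose orbits avoid the points of the subdivision. -/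
def regularPoints {N : ℕ} (T : unitInterval → unitInterval)
    (x : Fin (N + 1) → unitInterval) : Set unitInterval :=
  {y | ∀ k : ℕ, T^[k] y ∉ Set.range x}

theorem mem_atom_unique {N : ℕ} {x : Fin (N + 1) → unitInterval} (hx : StrictMono x) {i j : Fin N}
    {y : unitInterval} (hi : y ∈ atom x i) (hj : y ∈ atom x j) : i = j := by
  have key : ∀ a b : Fin N, y ∈ atom x a → y ∈ atom x b → ¬ a < b := by
    intro a b ha hb hab
    have h1 : a.succ ≤ b.castSucc := by
      rw [Fin.le_def]; simpa using hab
    exact absurd (ha.2.trans_le (hx.monotone h1)) (not_lt.2 hb.1.le)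
  exact le_antisymm (not_lt.1 (key j i hj hi)) (not_lt.1 (key i j hi hj))

theorem atom_lt_atom {N : ℕ} {x : Fin (N + 1) → unitInterval} (hx : StrictMono x) {i j : Fin N}
    (hij : i < j) {y z : unitInterval} (hy : y ∈ atom x i) (hz : z ∈ atom x j) : y < z := by
  have h1 : i.succ ≤ j.castSucc := by
    rw [Fin.le_def]; simpa using hij
  exact (hy.2.trans_le (hx.monotone h1)).trans hz.1

namespace IsAffineExpandingMarkov

variable {N : ℕ} {T : unitInterval → unitInterval} {x : Fin (N + 1) → unitInterval}

/-- The slope of `T` on the atom `i`. -/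
noncomputable def slope (hT : IsAffineExpandingMarkov T x) (i : Fin N) : ℝ :=
  (hT.affine_expanding i).choose

/-- The translation part of `T` on the atom `i`. -/
noncomputable def translation (hT : IsAffineExpandingMarkov T x) (i : Fin N) : ℝ :=
  (hT.affine_expanding i).choose_spec.choose

theorem one_lt_abs_slope (hT : IsAffineExpandingMarkov T x) (i : Fin N) : 1 < |hT.slope i| :=
  (hT.affine_expanding i).choose_spec.choose_spec.1

theorem slope_ne_zero (hT : IsAffineExpandingMarkov T x) (i : Fin N) : hT.slope i ≠ 0 := by
  intro h
  have := hT.one_lt_abs_slope i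
  rw [h] at this
  norm_num at this

theorem apply_eq (hT : IsAffineExpandingMarkov T x) {i : Fin N} {y : unitInterval}
    (hy : y ∈ atom x i) : (T y : ℝ) = hT.slope i * y + hT.translation i :=
  (hT.affine_expanding i).choose_spec.choose_spec.2 y hy

theorem pos (hT : IsAffineExpandingMarkov T x) : 0 < N := by
  rcases Nat.eq_zero_or_pos N with rfl | h
  · have h1 := hT.first
    have h2 := hT.last
    have h3 : (0 : Fin 1) = Fin.last 0 := rfl
    rw [← h3, h1] at h2
    exact absurd h2 zero_ne_one
  · exact h

theorem injOn (hT : IsAffineExpandingMarkov T x) (i : Fin N) : Set.InjOn T (atom x i) := by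
  intro y hy z hz h
  have h1 := hT.apply_eq hy
  rw [h, hT.apply_eq hz] at h1
  have h2 := mul_left_cancel₀ (hT.slope_ne_zero i) (add_right_cancel h1)
  exact Subtype.ext h2.symm

theorem monotoneOn_or_antitoneOn (hT : IsAffineExpandingMarkov T x) (i : Fin N) :
    MonotoneOn T (atom x i) ∨ AntitoneOn T (atom x i) := by
  rcases le_total 0 (hT.slope i) with h | h
  · left
    intro y hy z hz hyz
    rw [← Subtype.coe_le_coe, hT.apply_eq hy, hT.apply_eq hz]
    have : (y : ℝ) ≤ z := hyz
    nlinarith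
  · right
    intro y hy z hz hyz
    rw [← Subtype.coe_le_coe, hT.apply_eq hy, hT.apply_eq hz]
    have : (y : ℝ) ≤ z := hyz
    nlinarith

theorem dist_le_dist_apply (hT : IsAffineExpandingMarkov T x) {i : Fin N} {y z : unitInterval}
    (hy : y ∈ atom x i) (hz : z ∈ atom x i) : dist y z ≤ dist (T y) (T z) := by
  rw [Subtype.dist_eq, Subtype.dist_eq, Real.dist_eq, Real.dist_eq, hT.apply_eq hy, hT.apply_eq hz,
    add_sub_add_right_eq_sub, ← mul_sub, abs_mul]
  exact le_mul_of_one_le_left (abs_nonneg _) (hT.one_lt_abs_slope i).le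

theorem mem_range_or_mem_atom (hT : IsAffineExpandingMarkov T x) (y : unitInterval) :
    y ∈ Set.range x ∨ ∃ i, y ∈ atom x i := by
  by_cases hy : y ∈ Set.range x
  · exact Or.inl hy
  right
  have h0 : ∀ k : Fin (N + 1), x k ≠ y := fun k h => hy ⟨k, h⟩
  by_contra! hcon
  have key : ∀ k : Fin (N + 1), x k < y := by
    intro k
    induction k using Fin.induction with
    | zero => exact lt_of_le_of_ne (hT.first ▸ unitInterval.nonneg') (h0 0)
    | succ k ih => exact lt_of_le_of_ne (not_lt.1 fun h => hcon k ⟨ih, h⟩) (h0 _)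
  have := key (Fin.last N)
  rw [hT.last] at this
  exact absurd this (not_lt.2 unitInterval.le_one')

theorem apply_mem (hT : IsAffineExpandingMarkov T x) {i : Fin N} {y : unitInterval}
    (hy : y ∈ atom x i) : T y ∈ Set.range x ∨ ∃ j ∈ successors T x i, T y ∈ atom x j := by
  rcases hT.mem_range_or_mem_atom (T y) with h | ⟨j, hj⟩
  · exact Or.inl h
  · exact Or.inr ⟨j, mem_successors.2 (hT.markov i j ⟨T y, ⟨y, hy, rfl⟩, hj⟩), hj⟩

theorem exists_preimage {i j : Fin N} (hj : j ∈ successors T x i)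
    {z : unitInterval} (hz : z ∈ atom x j) : ∃ y ∈ atom x i, T y = z :=
  mem_successors.1 hj hz

theorem lt_atom (hT : IsAffineExpandingMarkov T x) (i : Fin N) : x i.castSucc < x i.succ :=
  hT.strictMono (by simp [Fin.lt_def])

theorem atom_not_countable (hT : IsAffineExpandingMarkov T x) (i : Fin N) :
    ¬ (atom x i).Countable := by
  intro h
  have h1 : ((fun y : unitInterval => (y : ℝ)) '' atom x i).Countable := h.image _
  have h2 : Set.Ioo ((x i.castSucc : unitInterval) : ℝ) (x i.succ) ⊆
      (fun y : unitInterval => (y : ℝ)) '' atom x i := by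
    intro r hr
    exact ⟨⟨r, (x i.castSucc).2.1.trans hr.1.le, hr.2.le.trans (x i.succ).2.2⟩, ⟨hr.1, hr.2⟩, rfl⟩
  have h3 := h1.mono h2
  exact (Cardinal.Real.Ioo_countable_iff.1 h3).not_gt (hT.lt_atom i)

theorem countable_preimage (hT : IsAffineExpandingMarkov T x) {C : Set unitInterval}
    (hC : C.Countable) : (T ⁻¹' C).Countable := by
  have h1 : T ⁻¹' C ⊆ Set.range x ∪ ⋃ i, (atom x i ∩ T ⁻¹' C) := by
    intro y hy
    rcases hT.mem_range_or_mem_atom y with h | ⟨i, hi⟩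
    · exact Or.inl h
    · exact Or.inr (Set.mem_iUnion.2 ⟨i, hi, hy⟩)
  refine Set.Countable.mono h1 ((Set.countable_range x).union (Set.countable_iUnion fun i => ?_))
  exact Set.MapsTo.countable_of_injOn (t := C) (fun y hy => hy.2)
    ((hT.injOn i).mono Set.inter_subset_left) hC

/-- `T` is injective on each atom, so each iterated preimage of the subdivision is countable,
whereas atoms are uncountable. Every atom therefore keeps regular points, which is how the arbitrary
values at the `x_i` are avoided. -/
theorem countable_compl_regularPoints (hT : IsAffineExpandingMarkov T x) :
    (regularPoints T x)ᶜ.Countable := by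
  have h1 : (regularPoints T x)ᶜ ⊆ ⋃ k : ℕ, T^[k] ⁻¹' Set.range x := by
    intro y hy
    simp only [regularPoints, Set.mem_compl_iff, Set.mem_ofPred_eq, not_forall, not_not] at hy
    exact Set.mem_iUnion.2 hy
  refine Set.Countable.mono h1 (Set.countable_iUnion fun k => ?_)
  induction k with
  | zero => simpa using Set.countable_range x
  | succ k ih =>
    rw [Function.iterate_succ, Set.preimage_comp]
    exact hT.countable_preimage ih

theorem regularPoints_inter_atom_not_countable (hT : IsAffineExpandingMarkov T x) (i : Fin N) :
    ¬ (regularPoints T x ∩ atom x i).Countable := fun h =>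
  hT.atom_not_countable i ((h.union hT.countable_compl_regularPoints).mono fun y hy => by
    by_cases h : y ∈ regularPoints T x
    · exact Or.inl ⟨h, hy⟩
    · exact Or.inr h)

theorem exists_pair_regularPoints (hT : IsAffineExpandingMarkov T x) (i : Fin N) :
    ∃ y z, y ∈ regularPoints T x ∧ z ∈ regularPoints T x ∧ y ∈ atom x i ∧ z ∈ atom x i ∧
      y ≠ z := by
  by_contra! h
  refine hT.regularPoints_inter_atom_not_countable i (Set.Subsingleton.countable ?_)
  intro y hy z hz
  exact h y z hy.1 hz.1 hy.2 hz.2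

theorem regularPoints_apply {y : unitInterval}
    (hy : y ∈ regularPoints T x) : T y ∈ regularPoints T x := fun k => by
  rw [← Function.iterate_succ_apply]; exact hy (k + 1)

theorem regularPoints_iterate {y : unitInterval}
    (hy : y ∈ regularPoints T x) (n : ℕ) : T^[n] y ∈ regularPoints T x := by
  induction n with
  | zero => exact hy
  | succ n ih => rw [Function.iterate_succ_apply']; exact regularPoints_apply ih

theorem mem_regularPoints_of_apply (hT : IsAffineExpandingMarkov T x) {i : Fin N}
    {y : unitInterval} (hy : y ∈ atom x i) (h : T y ∈ regularPoints T x) :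
    y ∈ regularPoints T x := by
  intro k
  cases k with
  | zero =>
    rintro ⟨l, hl⟩
    have hl' : x l = y := hl
    rw [← hl'] at hy
    have h1 := hT.strictMono.lt_iff_lt.1 hy.1
    have h2 := hT.strictMono.lt_iff_lt.1 hy.2
    rw [Fin.lt_def] at h1 h2
    simp at h1 h2
    omega
  | succ k => rw [Function.iterate_succ_apply]; exact h k

theorem exists_mem_atom_of_regular (hT : IsAffineExpandingMarkov T x) {y : unitInterval}
    (hy : y ∈ regularPoints T x) : ∃ i, y ∈ atom x i :=
  (hT.mem_range_or_mem_atom y).resolve_left (hy 0)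

theorem reachable (hirr : (transitionMatrix T x).IsIrreducible) (i j : Fin N) :
    Relation.ReflTransGen (fun a b => b ∈ successors T x a) i j := by
  let := Matrix.toQuiver (transitionMatrix T x)
  obtain ⟨p, -⟩ := hirr.connected i j
  induction p with
  | nil => exact Relation.ReflTransGen.refl
  | cons p e ih =>
    refine ih.tail ?_
    have h := e.down
    rw [mem_successors]
    by_contra hcon
    simp [transitionMatrix, hcon] at h

/-- Every edge of a finite strongly connected graph lies on a closed walk that visits each vertex at
most once; the walk follows a successor function. -/
theorem _root_.exists_periodic_selection {N : ℕ} {S : Fin N → Finset (Fin N)}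
    (hS : ∀ i j, Relation.ReflTransGen (fun a b => b ∈ S a) i j) {i j : Fin N} (hj : j ∈ S i) :
    ∃ f : Fin N → Fin N, (∀ k, f k ∈ S k) ∧ f i = j ∧
      ∃ L, 1 ≤ L ∧ L ≤ N ∧ f^[L] i = i := by
  classical
  -- `R n k` says that `n` edges lead from `k` to `i`; `d k` below is the distance to `i`.
  let R : ℕ → Fin N → Prop := fun n =>
    Nat.rec (motive := fun _ => Fin N → Prop) (fun k => k = i) (fun _ P k => ∃ l ∈ S k, P l) n
  have hR : ∀ k, ∃ n, R n k := by
    intro k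
    induction hS k i using Relation.ReflTransGen.head_induction_on with
    | refl => exact ⟨0, rfl⟩
    | head h _ ih => exact ⟨ih.choose + 1, _, h, ih.choose_spec⟩
  let d : Fin N → ℕ := fun k => Nat.find (p := fun n => R n k) (hR k)
  -- Leave `i` through the prescribed edge; elsewhere step closer to `i`. The orbit of `i` then
  -- returns, and a minimal period in `Fin N` is at most `N`.
  have hnext : ∀ k, ∃ l ∈ S k, (k = i → l = j) ∧ (k ≠ i → d l < d k) := by
    intro k
    by_cases hk : k = i
    · exact ⟨j, hk ▸ hj, fun _ => rfl, fun h => absurd hk h⟩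
    · have h1 : R (d k) k := Nat.find_spec (hR k)
      cases h2 : d k with
      | zero => rw [h2] at h1; exact absurd h1 hk
      | succ n =>
        rw [h2] at h1
        obtain ⟨l, hl, hl'⟩ := h1
        exact ⟨l, hl, fun h => absurd h hk, fun _ => Nat.lt_succ_of_le (Nat.find_min' (hR l) hl')⟩
  choose f hf hfi hfd using hnext
  have hreach : ∀ n k, d k = n → ∃ m, f^[m] k = i := by
    intro n
    induction n using Nat.strong_induction_on with
    | _ d ih =>
      intro k hk
      by_cases hki : k = i
      · exact ⟨0, hki⟩
      · obtain ⟨m, hm⟩ := ih _ (hk ▸ hfd k hki) (f k) rfl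
        exact ⟨m + 1, hm⟩
  obtain ⟨m, hm⟩ := hreach _ (f i) rfl
  have hper : i ∈ Function.periodicPts f := ⟨m + 1, Nat.succ_pos m, hm⟩
  refine ⟨f, hf, hfi i rfl, Function.minimalPeriod f i,
    Function.minimalPeriod_pos_of_mem_periodicPts hper, ?_, Function.iterate_minimalPeriod⟩
  simpa using Function.minimalPeriod_le_card (f := f) (x := i)

theorem successors_nonempty (hT : IsAffineExpandingMarkov T x) (i : Fin N) :
    (successors T x i).Nonempty := by
  obtain ⟨y, -, hy, -, hyi, -⟩ := hT.exists_pair_regularPoints i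
  rcases hT.apply_mem hyi with h | ⟨j, hj, -⟩
  · exact absurd h (hy 1)
  · exact ⟨j, hj⟩

end IsAffineExpandingMarkov

/-! ### Upper bounds for the variation -/

open scoped ENNReal

/-- In a strictly increasing sequence only the first term can be the least point `p`, so only one
increment is new. -/
theorem eVariationOn_insert_le {α E : Type*} [LinearOrder α] [PseudoEMetricSpace E] {f : α → E}
    {s : Set α} {p : α} {c : ℝ≥0∞} (hp : ∀ y ∈ s, p ≤ y) (hc : ∀ y z, edist (f y) (f z) ≤ c) :
    eVariationOn f (insert p s) ≤ eVariationOn f s + c := by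
  rw [eVariationOn.eVariationOn_eq_strictMonoOn]
  refine iSup_le ?_
  rintro ⟨n, u, u_mono, u_mem⟩
  have hmem : ∀ i, 1 ≤ i → i ≤ n → u i ∈ s := by
    intro i hi hin
    rcases u_mem i hin with h | h
    · have h1 : u 0 < u i := u_mono (by simp) hin (by omega)
      rcases u_mem 0 (by simp) with h0 | h0
      · rw [h, h0] at h1; exact absurd h1 (lt_irrefl _)
      · exact absurd (h ▸ h1) (not_lt.2 (hp _ h0))
    · exact h
  cases n with
  | zero => simp
  | succ n =>
    rw [Finset.sum_range_succ']
    refine add_le_add ?_ ?_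
    · refine eVariationOn.sum_le_of_monotoneOn_Iic (u := fun i => u (i + 1)) ?_ ?_
      · intro i hi j hj hij
        exact u_mono.monotoneOn (by simpa using hi) (by simpa using hj) (by omega)
      · intro i hi
        exact hmem _ (by omega) (by simpa using hi)
    · exact hc _ _

theorem eVariationOn_Icc_le_Ioo {α E : Type*} [LinearOrder α] [PseudoEMetricSpace E] {f : α → E}
    {a b : α} {c : ℝ≥0∞} (hab : a < b) (hc : ∀ y z, edist (f y) (f z) ≤ c) :
    eVariationOn f (Set.Icc a b) ≤ eVariationOn f (Set.Ioo a b) + 2 * c := by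
  have h1 : eVariationOn f (Set.Ico a b) ≤ eVariationOn f (Set.Ioo a b) + c := by
    rw [← Set.Ioo_insert_left hab]
    exact eVariationOn_insert_le (fun y hy => hy.1.le) fun y z => hc _ _
  have h2 : eVariationOn f (Set.Icc a b) ≤ eVariationOn f (Set.Ico a b) + c := by
    rw [← Set.Ico_insert_right hab.le, ← eVariationOn.comp_ofDual f,
      ← eVariationOn.comp_ofDual f (Set.Ico a b)]
    exact eVariationOn_insert_le (p := OrderDual.toDual b) (fun y hy => hy.2.le) fun y z => hc _ _
  calc _ ≤ _ := h2
    _ ≤ eVariationOn f (Set.Ioo a b) + c + c := by gcongr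
    _ = _ := by rw [two_mul, add_assoc]

theorem sum_eVariationOn_atom_le {N : ℕ} {x : Fin (N + 1) → unitInterval} (hx : StrictMono x)
    (J : Finset (Fin N)) (g : unitInterval → ℝ) :
    ∑ j ∈ J, eVariationOn g (atom x j) ≤ eVariationOn g (⋃ j ∈ J, atom x j) := by
  induction J using Finset.induction_on_max with
  | empty => simp
  | insert a J hJ ih =>
    rw [Finset.sum_insert fun h => lt_irrefl _ (hJ a h), add_comm, Finset.set_biUnion_insert,
      Set.union_comm]
    refine (add_le_add_left ih _).trans (eVariationOn.add_le_union g ?_)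
    intro y hy z hz
    simp only [Set.mem_iUnion] at hy
    obtain ⟨j, hj, hy⟩ := hy
    exact (atom_lt_atom hx (hJ j hj) hy hz).le

namespace IsAffineExpandingMarkov

variable {N : ℕ} {T : unitInterval → unitInterval} {x : Fin (N + 1) → unitInterval}

theorem eVariationOn_univ_le (hT : IsAffineExpandingMarkov T x) {g : unitInterval → ℝ}
    (hg : ∀ y, g y ∈ Set.Icc (0 : ℝ) 1) :
    eVariationOn g Set.univ ≤ ∑ i, eVariationOn g (atom x i) + 2 * N := by
  have hc : ∀ y z, edist (g y) (g z) ≤ 1 := by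
    intro y z
    rw [edist_dist, ← ENNReal.ofReal_one]
    refine ENNReal.ofReal_le_ofReal ?_
    rw [Real.dist_eq, abs_le]
    constructor <;> linarith [(hg y).1, (hg y).2, (hg z).1, (hg z).2]
  let I : ℕ → unitInterval := fun k => x ⟨min k N, by omega⟩
  have hI : Monotone I := fun a b hab => hT.strictMono.monotone (by
    rw [Fin.le_def]; exact min_le_min_right _ hab)
  have h0 : I 0 = 0 := by
    rw [← hT.first]; congr 1
  have h1 : I N = 1 := by
    rw [← hT.last]; simp [I, Fin.last]
  have huniv : Set.Icc (I 0) (I N) = Set.univ := by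
    rw [h0, h1]; exact Set.eq_univ_of_forall fun y => ⟨unitInterval.nonneg', unitInterval.le_one'⟩
  rw [← huniv, ← eVariationOn.sum' g hI, Finset.sum_range]
  have h2 : ∀ i : Fin N, eVariationOn g (Set.Icc (I i) (I (i + 1))) ≤
      eVariationOn g (atom x i) + 2 := by
    intro i
    have e1 : I i = x i.castSucc := by
      simp only [I]; congr 1; ext; simp
    have e2 : I (i + 1) = x i.succ := by
      simp only [I]; congr 1; ext; simp
    rw [e1, e2, atom]
    simpa using eVariationOn_Icc_le_Ioo (hT.lt_atom i) hc
  refine (Finset.sum_le_sum fun i _ => h2 i).trans ?_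
  rw [Finset.sum_add_distrib]
  simp [mul_comm]

theorem eVariationOn_image_atom_le (hT : IsAffineExpandingMarkov T x) (i : Fin N)
    {g : unitInterval → ℝ} (hg : ∀ y, g y ∈ Set.Icc (0 : ℝ) 1) :
    eVariationOn g (T '' atom x i) ≤
      ∑ j ∈ successors T x i, eVariationOn g (atom x j) + 2 * N := by
  classical
  -- Cutting `g` off outside the image keeps its values in `[0, 1]` and makes it zero on the atoms
  -- that are not successors, so the bound on the whole interval applies.
  set S := T '' atom x i
  have hg' : ∀ y, S.indicator g y ∈ Set.Icc (0 : ℝ) 1 := by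
    intro y
    by_cases hy : y ∈ S
    · rw [Set.indicator_of_mem hy]; exact hg y
    · rw [Set.indicator_of_notMem hy]; simp
  have h1 : eVariationOn g S ≤ eVariationOn (S.indicator g) Set.univ := by
    rw [← eVariationOn.congr (f := S.indicator g) (s := S) fun y hy => Set.indicator_of_mem hy g]
    exact eVariationOn.mono _ (Set.subset_univ _)
  refine h1.trans ((hT.eVariationOn_univ_le hg').trans (add_le_add_left ?_ _))
  rw [← Finset.sum_subset (Finset.subset_univ (successors T x i))]
  · refine Finset.sum_le_sum fun j hj => le_of_eq (eVariationOn.congr fun y hy => ?_)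
    exact Set.indicator_of_mem (mem_successors.1 hj hy) g
  · intro j _ hj
    refine eVariationOn.constant_on ?_
    rintro _ ⟨y, hy, rfl⟩ _ ⟨z, hz, rfl⟩
    have key : ∀ y ∈ atom x j, S.indicator g y = 0 := fun y hy =>
      Set.indicator_of_notMem (fun h => hj (mem_successors.2 (hT.markov i j ⟨y, h, hy⟩))) g
    rw [key y hy, key z hz]

theorem eVariationOn_comp_atom (hT : IsAffineExpandingMarkov T x) (i : Fin N)
    (g : unitInterval → ℝ) :
    eVariationOn (g ∘ T) (atom x i) = eVariationOn g (T '' atom x i) := by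
  rcases hT.monotoneOn_or_antitoneOn i with h | h
  · exact eVariationOn.comp_eq_of_monotoneOn g T h
  · exact eVariationOn.comp_eq_of_antitoneOn g T h

theorem eVariationOn_iterate_atom_le (hT : IsAffineExpandingMarkov T x) (n : ℕ) (i : Fin N) :
    eVariationOn (fun y => (T^[n] y : ℝ)) (atom x i) ≤
      (2 * N + 1 : ℕ) * ((∑ k ∈ Finset.range (n + 1), walkCount T x k i : ℕ) : ℝ≥0∞) := by
  induction n generalizing i with
  | zero =>
    have h1 : eVariationOn (fun y : unitInterval => (y : ℝ)) (Set.univ ∩ Set.Icc 0 1) ≤ 1 := by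
      have hm : MonotoneOn (fun y : unitInterval => (y : ℝ)) Set.univ := fun a _ b _ h => h
      simpa using (hm.eVariationOn_eq (Set.mem_univ 0) (Set.mem_univ 1)).le
    have h2 : atom x i ⊆ Set.univ ∩ Set.Icc 0 1 := fun y _ =>
      ⟨trivial, unitInterval.nonneg', unitInterval.le_one'⟩
    refine ((eVariationOn.mono _ h2).trans h1).trans ?_
    simp [walkCount]
  | succ n ih =>
    have h1 : (fun y => (T^[n + 1] y : ℝ)) = (fun y => (T^[n] y : ℝ)) ∘ T := by
      funext y; simp
    rw [h1, hT.eVariationOn_comp_atom]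
    refine (hT.eVariationOn_image_atom_le i fun y => (T^[n] y).2).trans ?_
    refine (add_le_add_left (Finset.sum_le_sum fun j _ => ih j) _).trans ?_
    rw [Finset.sum_range_succ' _ (n + 1), ← Finset.mul_sum, ← Nat.cast_sum, Finset.sum_comm]
    simp only [walkCount]
    norm_cast
    rw [mul_add]
    omega

theorem walkCount_le_succ (hT : IsAffineExpandingMarkov T x) (n : ℕ) (i : Fin N) :
    walkCount T x n i ≤ walkCount T x (n + 1) i := by
  induction n generalizing i with
  | zero =>
    simp only [walkCount, Finset.sum_const, smul_eq_mul, mul_one]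
    exact (hT.successors_nonempty i).card_pos
  | succ n ih => exact Finset.sum_le_sum fun j _ => ih j

theorem walkCount_mono (hT : IsAffineExpandingMarkov T x) (i : Fin N) :
    Monotone fun n => walkCount T x n i :=
  monotone_nat_of_le_succ fun n => hT.walkCount_le_succ n i

/-- Walk counts increase with length, so the sum over lengths `k ≤ n` costs only a factor `n + 1`,
harmless against a geometric gap. -/
theorem eVariationOn_iterate_le (hT : IsAffineExpandingMarkov T x) (n : ℕ) :
    eVariationOn (fun y => (T^[n] y : ℝ)) Set.univ ≤
      ((4 * N + 1) * (n + 1) * ∑ i, walkCount T x n i : ℕ) := by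
  refine (hT.eVariationOn_univ_le fun y => (T^[n] y).2).trans ?_
  refine (add_le_add_left (Finset.sum_le_sum fun i _ =>
    hT.eVariationOn_iterate_atom_le n i) _).trans ?_
  rw [← Finset.mul_sum]
  norm_cast
  have h1 : ∑ i, ∑ k ∈ Finset.range (n + 1), walkCount T x k i ≤
      (n + 1) * ∑ i, walkCount T x n i := by
    rw [Finset.mul_sum]
    refine Finset.sum_le_sum fun i _ => ?_
    refine (Finset.sum_le_card_nsmul _ _ (walkCount T x n i) fun k hk => ?_).trans (by simp)
    exact hT.walkCount_mono i (by rw [Finset.mem_range] at hk; omega)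
  have h2 : 1 ≤ (n + 1) * ∑ i, walkCount T x n i := by
    refine Nat.mul_pos (Nat.succ_pos n) ?_
    have h3 : walkCount T x 0 ⟨0, hT.pos⟩ ≤ walkCount T x n ⟨0, hT.pos⟩ :=
      hT.walkCount_mono _ (Nat.zero_le n)
    exact lt_of_lt_of_le h3 (Finset.single_le_sum (f := fun i => walkCount T x n i)
      (fun _ _ => Nat.zero_le _) (Finset.mem_univ _))
  calc _ ≤ (2 * N + 1) * ((n + 1) * ∑ i, walkCount T x n i) +
        2 * N * ((n + 1) * ∑ i, walkCount T x n i) :=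
        add_le_add (Nat.mul_le_mul_left _ h1) (Nat.le_mul_of_pos_right _ h2)
    _ = _ := by ring

end IsAffineExpandingMarkov

theorem summable_syncFun (T : unitInterval → unitInterval) {γ : ℝ} (h0 : 0 < γ) (h1 : γ < 1)
    (y : unitInterval) : Summable fun k : ℕ => γ ^ k * ((T^[k + 1] y : unitInterval) : ℝ) := by
  refine Summable.of_nonneg_of_le (fun k => ?_) (fun k => ?_)
    (summable_geometric_of_lt_one h0.le h1)
  · exact mul_nonneg (pow_nonneg h0.le k) (T^[k + 1] y).2.1
  · exact mul_le_of_le_one_right (pow_nonneg h0.le k) (T^[k + 1] y).2.2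

theorem syncFun_eq (T : unitInterval → unitInterval) {γ : ℝ} (h0 : 0 < γ) (h1 : γ < 1)
    (y : unitInterval) : syncFun T γ y = T y + γ * syncFun T γ (T y) := by
  rw [syncFun, (summable_syncFun T h0 h1 y).tsum_eq_zero_add, syncFun, ← tsum_mul_left]
  simp only [pow_zero, one_mul, zero_add, Function.iterate_one, pow_succ]
  congr 1
  refine tsum_congr fun k => ?_
  rw [Function.iterate_succ_apply T (k + 1)]
  ring

theorem eVariationOn_syncFun_le (T : unitInterval → unitInterval) {γ : ℝ} (h0 : 0 < γ)
    (h1 : γ < 1) : eVariationOn (syncFun T γ) Set.univ ≤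
      ∑' k : ℕ, ENNReal.ofReal (γ ^ k) * eVariationOn (fun y => (T^[k + 1] y : ℝ)) Set.univ := by
  refine iSup_le ?_
  rintro ⟨n, u, hu, -⟩
  have h2 : ∀ y z, edist (syncFun T γ y) (syncFun T γ z) ≤
      ∑' k : ℕ, ENNReal.ofReal (γ ^ k) * edist (T^[k + 1] y : ℝ) (T^[k + 1] z : ℝ) := by
    intro y z
    have hs : Summable fun k : ℕ => γ ^ k * dist (T^[k + 1] y : ℝ) (T^[k + 1] z : ℝ) := by
      refine Summable.of_nonneg_of_le (fun k => ?_) (fun k => ?_)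
        (summable_geometric_of_lt_one h0.le h1)
      · positivity
      · refine mul_le_of_le_one_right (pow_nonneg h0.le k) ?_
        have a1 := (T^[k + 1] y).2
        have a2 := (T^[k + 1] z).2
        rw [Real.dist_eq, abs_le]
        constructor <;> linarith [a1.1, a1.2, a2.1, a2.2]
    have e1 : ∀ k : ℕ, ENNReal.ofReal (γ ^ k) * edist (T^[k + 1] y : ℝ) (T^[k + 1] z : ℝ) =
        ENNReal.ofReal (γ ^ k * dist (T^[k + 1] y : ℝ) (T^[k + 1] z : ℝ)) := fun k => by
      rw [edist_dist, ENNReal.ofReal_mul (pow_nonneg h0.le k)]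
    rw [tsum_congr e1, ← ENNReal.ofReal_tsum_of_nonneg (fun k => by positivity) hs, edist_dist]
    refine ENNReal.ofReal_le_ofReal ?_
    rw [Real.dist_eq, syncFun, syncFun,
      ← (summable_syncFun T h0 h1 y).tsum_sub (summable_syncFun T h0 h1 z)]
    have e2 : ∀ k : ℕ, γ ^ k * dist (T^[k + 1] y : ℝ) (T^[k + 1] z : ℝ) =
        ‖γ ^ k * (T^[k + 1] y : ℝ) - γ ^ k * (T^[k + 1] z : ℝ)‖ := fun k => by
      rw [← mul_sub, norm_mul, Real.norm_of_nonneg (pow_nonneg h0.le k), Real.dist_eq,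
        Real.norm_eq_abs]
    rw [tsum_congr e2, ← Real.norm_eq_abs]
    exact norm_tsum_le_tsum_norm (by simpa only [← e2] using hs)
  calc _ ≤ ∑ i ∈ Finset.range n, ∑' k : ℕ, ENNReal.ofReal (γ ^ k) *
        edist (T^[k + 1] (u (i + 1)) : ℝ) (T^[k + 1] (u i) : ℝ) :=
        Finset.sum_le_sum fun i _ => h2 _ _
    _ = ∑' k : ℕ, ∑ i ∈ Finset.range n, ENNReal.ofReal (γ ^ k) *
        edist (T^[k + 1] (u (i + 1)) : ℝ) (T^[k + 1] (u i) : ℝ) :=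
        (Summable.tsum_finsetSum fun _ _ => ENNReal.summable).symm
    _ ≤ _ := by
        refine ENNReal.tsum_le_tsum fun k => ?_
        rw [← Finset.mul_sum]
        gcongr
        exact eVariationOn.sum_le (f := fun y => (T^[k + 1] y : ℝ)) hu fun i => Set.mem_univ _

theorem IsAffineExpandingMarkov.eVariationOn_syncFun_lt_top {N : ℕ}
    {T : unitInterval → unitInterval} {x : Fin (N + 1) → unitInterval}
    (hT : IsAffineExpandingMarkov T x) {γ : ℝ} (h0 : 0 < γ) (h1 : γ < 1) {C ρ : ℝ} (hρ : 0 < ρ)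
    (hργ : ρ * γ < 1) (hC : ∀ n, ((∑ i, walkCount T x n i : ℕ) : ℝ) ≤ C * ρ ^ n) :
    eVariationOn (syncFun T γ) Set.univ < ⊤ := by
  have hC0 : 0 ≤ C := by simpa using (Nat.cast_nonneg _).trans (hC 0)
  refine (eVariationOn_syncFun_le T h0 h1).trans_lt ?_
  have hb : ∀ k : ℕ, ENNReal.ofReal (γ ^ k) * eVariationOn (fun y => (T^[k + 1] y : ℝ)) Set.univ ≤
      ENNReal.ofReal (((4 * N + 1) * C * ρ) * ((k + 2) * (ρ * γ) ^ k)) := by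
    intro k
    refine (mul_le_mul_right (hT.eVariationOn_iterate_le (k + 1)) _).trans ?_
    rw [← ENNReal.ofReal_natCast, ← ENNReal.ofReal_mul (by positivity)]
    refine ENNReal.ofReal_le_ofReal ?_
    have h2 := hC (k + 1)
    rw [Nat.cast_mul]
    calc γ ^ k * (((4 * N + 1) * (k + 1 + 1) : ℕ) * ((∑ i, walkCount T x (k + 1) i : ℕ) : ℝ)) ≤
        γ ^ k * (((4 * N + 1) * (k + 1 + 1) : ℕ) * (C * ρ ^ (k + 1))) := by gcongr
      _ = _ := by push_cast; ring
  refine (ENNReal.tsum_le_tsum hb).trans_lt ?_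
  have hρ0 : 0 ≤ ρ * γ := by positivity
  have hs : Summable fun k : ℕ => ((4 * N + 1) * C * ρ) * (((k : ℝ) + 2) * (ρ * γ) ^ k) := by
    refine Summable.mul_left _ ?_
    simp only [add_mul]
    refine Summable.add ?_ ((summable_geometric_of_lt_one hρ0 hργ).mul_left 2)
    simpa using summable_pow_mul_geometric_of_norm_lt_one 1
      (by rwa [Real.norm_of_nonneg hρ0] : ‖ρ * γ‖ < 1)
  rw [← ENNReal.ofReal_tsum_of_nonneg (fun k => by positivity) hs]
  exact ENNReal.ofReal_lt_top

/-! ### Variation modulo linear functions -/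

open scoped ENNReal

/-- The least variation on `s` of the function `g`, up to addition of a linear function. -/
noncomputable def variationModAffine (g : unitInterval → ℝ) (s : Set unitInterval) : ℝ≥0∞ :=
  ⨅ a : ℝ, eVariationOn (fun y => g y + a * y) s

theorem variationModAffine_le (g : unitInterval → ℝ) (s : Set unitInterval) :
    variationModAffine g s ≤ eVariationOn g s :=
  (iInf_le _ 0).trans (by simp)

theorem exists_affine_of_variationModAffine_eq_zero {g : unitInterval → ℝ} {s : Set unitInterval}
    (h : variationModAffine g s = 0) {p q : unitInterval} (hp : p ∈ s) (hq : q ∈ s) (hpq : p ≠ q) :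
    ∃ α β : ℝ, ∀ y ∈ s, g y = α * y + β := by
  have hpq' : (q : ℝ) - p ≠ 0 := fun h => hpq (Subtype.ext (by linarith))
  have key : ∀ z ∈ s, (g z - g p) * (q - p) = (g q - g p) * (z - p) := by
    intro z hz
    refine eq_of_forall_dist_le fun ε hε => ?_
    have h1 : variationModAffine g s < ENNReal.ofReal (ε / 2) := by
      rw [h]; exact ENNReal.ofReal_pos.2 (half_pos hε)
    obtain ⟨a, ha⟩ := iInf_lt_iff.1 h1
    have h2 : ∀ y ∈ s, |(g y + a * y) - (g p + a * p)| ≤ ε / 2 := by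
      intro y hy
      have h3 := (eVariationOn.edist_le (fun y : unitInterval => g y + a * y) hy hp).trans ha.le
      rwa [edist_dist, ENNReal.ofReal_le_ofReal_iff (half_pos hε).le, Real.dist_eq] at h3
    have hb : ∀ y w : unitInterval, |(y : ℝ) - w| ≤ 1 := fun y w => by
      rw [abs_le]; constructor <;> linarith [y.2.1, y.2.2, w.2.1, w.2.2]
    -- The infimum need not be attained a priori, but this collinearity defect does not change when
    -- a linear function is added to `g`, so near-minimizers suffice.
    have e : (g z - g p) * (q - p) - (g q - g p) * (z - p) =
        ((g z + a * z) - (g p + a * p)) * (q - p) - ((g q + a * q) - (g p + a * p)) * (z - p) := by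
      ring
    rw [Real.dist_eq, e]
    refine (abs_sub _ _).trans ?_
    rw [abs_mul, abs_mul]
    have h4 := mul_le_of_le_one_right (abs_nonneg ((g z + a * z) - (g p + a * p))) (hb q p)
    have h5 := mul_le_of_le_one_right (abs_nonneg ((g q + a * q) - (g p + a * p))) (hb z p)
    linarith [h2 z hz, h2 q hq]
  refine ⟨(g q - g p) / (q - p), g p - (g q - g p) / (q - p) * p, fun y hy => ?_⟩
  have := key y hy
  field_simp
  linarith

theorem mul_eVariationOn_le {f : unitInterval → ℝ} {s : Set unitInterval} {γ c : ℝ} (hγ : 0 < γ) :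
    ENNReal.ofReal γ * eVariationOn f s ≤ eVariationOn (fun y => γ * f y + c) s := by
  rw [eVariationOn, ENNReal.mul_iSup]
  refine iSup_le ?_
  rintro ⟨n, u, hu, hs⟩
  rw [Finset.mul_sum]
  refine le_trans (le_of_eq (Finset.sum_congr rfl fun i _ => ?_))
    (eVariationOn.sum_le (f := fun y => γ * f y + c) (n := n) hu hs)
  rw [edist_dist, edist_dist, ← ENNReal.ofReal_mul hγ.le, Real.dist_eq, Real.dist_eq,
    add_sub_add_right_eq_sub, ← mul_sub, abs_mul, abs_of_pos hγ]

namespace IsAffineExpandingMarkov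

variable {N : ℕ} {T : unitInterval → unitInterval} {x : Fin (N + 1) → unitInterval}

theorem variationModAffine_syncFun_ge (hT : IsAffineExpandingMarkov T x) {γ : ℝ} (h0 : 0 < γ)
    (h1 : γ < 1) (i : Fin N) :
    ENNReal.ofReal γ * ∑ j ∈ successors T x i, variationModAffine (syncFun T γ) (atom x j) ≤
      variationModAffine (syncFun T γ) (atom x i) := by
  refine le_iInf fun a => ?_
  set s := hT.slope i
  have hs : s ≠ 0 := hT.slope_ne_zero i
  set t := hT.translation i
  -- Substituting `y = (T y - t) / s` in `T y + γ φ(T y) + a y` gives `γ (φ + a' z)` at `z = T y`,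
  -- up to a constant.
  set a' : ℝ := (1 + a / s) / γ
  have e1 : Set.EqOn (fun y : unitInterval => syncFun T γ y + a * y)
      ((fun z : unitInterval => γ * (syncFun T γ z + a' * z) + -(a * t / s)) ∘ T) (atom x i) := by
    intro y hy
    simp only [Function.comp, a']
    rw [syncFun_eq T h0 h1 y]
    have h2 : (T y : ℝ) = s * y + t := hT.apply_eq hy
    rw [h2]
    field_simp
    ring
  rw [eVariationOn.congr e1, hT.eVariationOn_comp_atom]
  have h2 : ⋃ j ∈ successors T x i, atom x j ⊆ T '' atom x i :=
    Set.iUnion₂_subset fun j hj => mem_successors.1 hj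
  refine le_trans ?_ (eVariationOn.mono _ h2)
  refine le_trans ?_ (sum_eVariationOn_atom_le hT.strictMono _ _)
  rw [Finset.mul_sum]
  refine Finset.sum_le_sum fun j _ => le_trans ?_ (mul_eVariationOn_le h0)
  gcongr
  exact iInf_le _ a'

theorem walkCount_mul_le_variationModAffine (hT : IsAffineExpandingMarkov T x) {γ : ℝ}
    (h0 : 0 < γ) (h1 : γ < 1) {δ : ℝ≥0∞}
    (hδ : ∀ j, δ ≤ variationModAffine (syncFun T γ) (atom x j)) (n : ℕ) (i : Fin N) :
    ENNReal.ofReal γ ^ n * walkCount T x n i * δ ≤ variationModAffine (syncFun T γ) (atom x i) := by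
  induction n generalizing i with
  | zero => simpa [walkCount] using hδ i
  | succ n ih =>
    refine le_trans (le_of_eq ?_) ((mul_le_mul_right (Finset.sum_le_sum fun j _ => ih j) _).trans
      (hT.variationModAffine_syncFun_ge h0 h1 i))
    rw [walkCount, Nat.cast_sum, Finset.mul_sum, Finset.mul_sum, Finset.sum_mul]
    refine Finset.sum_congr rfl fun j _ => ?_
    rw [pow_succ]
    ring

/-- If `syncFun T γ` has finite variation, then either the number of walks grows at most like
`γ⁻¹ ^ n`, or `syncFun T γ` is affine on each atom. -/
theorem walkCount_bounded_or_affine (hT : IsAffineExpandingMarkov T x)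
    (hirr : (transitionMatrix T x).IsIrreducible) {γ : ℝ} (h0 : 0 < γ) (h1 : γ < 1)
    (hfin : eVariationOn (syncFun T γ) Set.univ ≠ ⊤) :
    (∃ C : ℝ, ∀ n i, γ ^ n * walkCount T x n i ≤ C) ∨
      ∃ α β : Fin N → ℝ, ∀ i, ∀ y ∈ atom x i, syncFun T γ y = α i * y + β i := by
  set W : Fin N → ℝ≥0∞ := fun i => variationModAffine (syncFun T γ) (atom x i)
  have hγ : ENNReal.ofReal γ ≠ 0 := (ENNReal.ofReal_pos.2 h0).ne'
  by_cases hW : ∃ i, W i = 0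
  · right
    obtain ⟨i, hi⟩ := hW
    have hall : ∀ j, W j = 0 := by
      intro j
      induction reachable hirr i j with
      | refl => exact hi
      | @tail b c _ h ih =>
        have h2 := hT.variationModAffine_syncFun_ge h0 h1 b
        rw [show variationModAffine _ _ = 0 from ih, nonpos_iff_eq_zero, mul_eq_zero] at h2
        exact Finset.sum_eq_zero_iff.1 (h2.resolve_left hγ) _ h
    have h3 : ∀ j, ∃ α β : ℝ, ∀ y ∈ atom x j, syncFun T γ y = α * y + β := by
      intro j
      obtain ⟨p, q, -, -, hp, hq, hpq⟩ := hT.exists_pair_regularPoints j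
      exact exists_affine_of_variationModAffine_eq_zero (hall j) hp hq hpq
    choose α β h using h3
    exact ⟨α, β, h⟩
  · left
    push Not at hW
    have : Nonempty (Fin N) := ⟨⟨0, hT.pos⟩⟩
    obtain ⟨i0, hi0⟩ := Finite.exists_min W
    have hle : ∀ i, W i ≤ eVariationOn (syncFun T γ) Set.univ := fun i =>
      (variationModAffine_le _ _).trans (eVariationOn.mono _ (Set.subset_univ _))
    have hδt : W i0 ≠ ⊤ := ne_top_of_le_ne_top hfin (hle i0)
    refine ⟨(eVariationOn (syncFun T γ) Set.univ / W i0).toReal, fun n i => ?_⟩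
    have h2 := (hT.walkCount_mul_le_variationModAffine h0 h1 hi0 n i).trans (hle i)
    rw [← ENNReal.le_div_iff_mul_le (Or.inl (hW i0)) (Or.inl hδt)] at h2
    have h3 := ENNReal.toReal_mono (ENNReal.div_ne_top hfin (hW i0)) h2
    rwa [ENNReal.toReal_mul, ENNReal.toReal_pow, ENNReal.toReal_ofReal h0.le,
      ENNReal.toReal_natCast] at h3

/-- On the part of atom `i` sent into atom `j`, the functional equation equates two affine
functions; two distinct points there identify the coefficients. -/
theorem affine_relations (hT : IsAffineExpandingMarkov T x) {γ : ℝ} (h0 : 0 < γ) (h1 : γ < 1)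
    {α β : Fin N → ℝ} (h : ∀ i, ∀ y ∈ atom x i, syncFun T γ y = α i * y + β i) {i j : Fin N}
    (hj : j ∈ successors T x i) :
    α i = hT.slope i * (1 + γ * α j) ∧ β i = hT.translation i * (1 + γ * α j) + γ * β j := by
  obtain ⟨p', q', -, -, hp', hq', hpq⟩ := hT.exists_pair_regularPoints j
  obtain ⟨p, hp, rfl⟩ := exists_preimage hj hp'
  obtain ⟨q, hq, rfl⟩ := exists_preimage hj hq'
  have hne : (p : ℝ) - q ≠ 0 := fun h => hpq (by rw [Subtype.ext (by linarith : (p : ℝ) = q)])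
  have key : ∀ y ∈ atom x i, T y ∈ atom x j → α i * y + β i =
      (hT.slope i * (1 + γ * α j)) * y + (hT.translation i * (1 + γ * α j) + γ * β j) := by
    intro y hy hy'
    rw [← h i y hy, syncFun_eq T h0 h1, h j _ hy', hT.apply_eq hy]
    ring
  have h2 := key p hp hp'
  have h3 := key q hq hq'
  have h4 : α i = hT.slope i * (1 + γ * α j) := by
    refine mul_right_cancel₀ hne ?_
    linear_combination h2 - h3
  refine ⟨h4, ?_⟩
  rw [← h4] at h2
  linarith

end IsAffineExpandingMarkov

/-! ### Entropy is at most the growth rate of walks -/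

open scoped ENNReal Uniformity

namespace IsAffineExpandingMarkov

variable {N : ℕ} {T : unitInterval → unitInterval} {x : Fin (N + 1) → unitInterval}

/-- Covers of the successors are pulled back through the branch on atom `i`. By expansion, closeness
of the images implies closeness at time 0. Points sent to the subdivision are added separately, at
most `N + 1` of them. -/
theorem exists_cover_atom (hT : IsAffineExpandingMarkov T x) {ε : ℝ} (hε : 0 < ε) :
    ∃ A : ℕ, ∀ n i, ∃ s : Finset unitInterval, (∀ z ∈ s, z ∈ atom x i) ∧
      s.card ≤ A * ∑ k ∈ Finset.range (n + 1), walkCount T x k i ∧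
      ∀ y ∈ atom x i, ∃ z ∈ s, ∀ k < n + 1, dist (T^[k] y) (T^[k] z) < ε := by
  classical
  have hnet : ∀ i : Fin N, ∃ s : Finset unitInterval, (∀ z ∈ s, z ∈ atom x i) ∧
      ∀ y ∈ atom x i, ∃ z ∈ s, dist y z < ε := by
    intro i
    obtain ⟨t, hts, htf, ht⟩ := Metric.finite_approx_of_totallyBounded
      (isCompact_univ.totallyBounded.subset (Set.subset_univ (atom x i))) ε hε
    refine ⟨htf.toFinset, fun z hz => hts (htf.mem_toFinset.1 hz), fun y hy => ?_⟩
    obtain ⟨z, hz, hyz⟩ := Set.mem_iUnion₂.1 (ht hy)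
    exact ⟨z, htf.mem_toFinset.2 hz, hyz⟩
  choose net net_sub hnet using hnet
  refine ⟨∑ i, (net i).card + (N + 1), fun n => ?_⟩
  set A := ∑ i, (net i).card + (N + 1) with hA
  induction n with
  | zero =>
    intro i
    refine ⟨net i, net_sub i, ?_, fun y hy => ?_⟩
    · have := Finset.single_le_sum (f := fun i => (net i).card) (fun _ _ => Nat.zero_le _)
        (Finset.mem_univ i)
      simp only [zero_add, Finset.range_one, Finset.sum_singleton, walkCount, mul_one]
      exact this.trans (Nat.le_add_right _ _)
    · obtain ⟨z, hz, hyz⟩ := hnet i y hy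
      refine ⟨z, hz, fun k hk => ?_⟩
      obtain rfl : k = 0 := by omega
      exact hyz
  | succ n ih =>
    intro i
    choose s s_sub s_card hs using ih
    -- The inverse branch on atom `i`. Default values that fall outside the atom are filtered out of
    -- `s'`.
    let back : unitInterval → unitInterval := fun z => if h : ∃ y ∈ atom x i, T y = z then h.choose else z
    have hback : ∀ y ∈ atom x i, back (T y) = y := by
      intro y hy
      have h : ∃ w ∈ atom x i, T w = T y := ⟨y, hy, rfl⟩
      simp only [back, dif_pos h]
      exact hT.injOn i h.choose_spec.1 hy h.choose_spec.2
    let s' : Finset unitInterval :=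
      (((successors T x i).biUnion s ∪ Finset.univ.image x).image back).filter (· ∈ atom x i)
    refine ⟨s', fun z hz => (Finset.mem_filter.1 hz).2, ?_, ?_⟩
    · calc s'.card ≤ _ := (Finset.card_filter_le _ _).trans Finset.card_image_le
        _ ≤ ((successors T x i).biUnion s).card + (Finset.univ.image x).card :=
          Finset.card_union_le _ _
        _ ≤ ∑ j ∈ successors T x i, A * ∑ k ∈ Finset.range (n + 1), walkCount T x k j + (N + 1) := by
          refine add_le_add (Finset.card_biUnion_le.trans (Finset.sum_le_sum fun j _ => s_card j)) ?_
          exact Finset.card_image_le.trans (by simp)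
        _ ≤ _ := by
          rw [Finset.sum_range_succ' _ (n + 1), ← Finset.mul_sum, Finset.sum_comm, mul_add]
          simp only [walkCount]
          omega
    · intro y hy
      rcases hT.apply_mem hy with ⟨l, hl⟩ | ⟨j, hj, hyj⟩
      · refine ⟨y, Finset.mem_filter.2 ⟨Finset.mem_image.2 ⟨T y, ?_, hback y hy⟩, hy⟩,
          fun k _ => by rwa [dist_self]⟩
        exact Finset.mem_union_right _ (Finset.mem_image.2 ⟨l, Finset.mem_univ _, hl⟩)
      · obtain ⟨z', hz', hyz⟩ := hs j (T y) hyj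
        obtain ⟨z, hz, rfl⟩ := exists_preimage hj (s_sub j z' hz')
        refine ⟨z, Finset.mem_filter.2 ⟨Finset.mem_image.2 ⟨T z, ?_, hback z hz⟩, hz⟩,
          fun k hk => ?_⟩
        · exact Finset.mem_union_left _ (Finset.mem_biUnion.2 ⟨j, hj, hz'⟩)
        · cases k with
          | zero => exact (hT.dist_le_dist_apply hy hz).trans_lt (hyz 0 (Nat.succ_pos n))
          | succ k =>
            rw [Function.iterate_succ_apply, Function.iterate_succ_apply]
            exact hyz k (by omega)

theorem exp_topEntropy_mul_le_one (hT : IsAffineExpandingMarkov T x) {γ C : ℝ} (h0 : 0 < γ)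
    (h1 : γ < 1) (hC : ∀ n i, γ ^ n * walkCount T x n i ≤ C) :
    EReal.exp (topEntropy T) * ENNReal.ofReal γ ≤ 1 := by
  classical
  have hC0 : 0 ≤ C := (by positivity : (0 : ℝ) ≤ γ ^ 0 * walkCount T x 0 ⟨0, hT.pos⟩).trans (hC 0 _)
  suffices h : topEntropy T ≤ ENNReal.log (ENNReal.ofReal γ⁻¹) by
    have h2 := EReal.exp_monotone h
    rw [ENNReal.exp_log] at h2
    refine (mul_le_mul_left h2 _).trans ?_
    rw [← ENNReal.ofReal_mul (inv_nonneg.2 h0.le), inv_mul_cancel₀ h0.ne', ENNReal.ofReal_one]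
  refine iSup₂_le fun U hU => ?_
  obtain ⟨ε, hε, hεU⟩ := Metric.mem_uniformity_dist.1 hU
  obtain ⟨A, hA⟩ := hT.exists_cover_atom hε
  -- `(1 - γ)⁻¹` bounds the geometric sum over walk lengths; `N + 1` counts the subdivision points.
  set B : ℝ := A * N * (C * (1 - γ)⁻¹) + (N + 1) with hB
  have hB0 : 0 < B := by
    have : 0 < 1 - γ := by linarith
    positivity
  have hcov : ∀ n : ℕ, ((Dynamics.coverMincard T Set.univ U (n + 1) : ℕ∞) : ℝ≥0∞) ≤
      ENNReal.ofReal B * ENNReal.ofReal γ⁻¹ ^ (n + 1) := by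
    intro n
    choose s _ s_card hs using hA n
    let t : Finset unitInterval := Finset.univ.biUnion s ∪ Finset.univ.image x
    have ht : Dynamics.IsDynCoverOf T Set.univ U (n + 1) (t : Set unitInterval) := by
      intro y _
      rcases hT.mem_range_or_mem_atom y with ⟨l, hl⟩ | ⟨i, hi⟩
      · refine ⟨y, Finset.mem_coe.2 (Finset.mem_union_right _
          (Finset.mem_image.2 ⟨l, Finset.mem_univ _, hl⟩)), ?_⟩
        exact Dynamics.mem_dynEntourage.2 fun k _ => hεU (by rwa [dist_self])
      · obtain ⟨z, hz, hyz⟩ := hs i y hi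
        refine ⟨z, Finset.mem_coe.2 (Finset.mem_union_left _
          (Finset.mem_biUnion.2 ⟨i, Finset.mem_univ _, hz⟩)), ?_⟩
        exact Dynamics.mem_dynEntourage.2 fun k hk => hεU (hyz k hk)
    have h2 : ((Dynamics.coverMincard T Set.univ U (n + 1) : ℕ∞) : ℝ≥0∞) ≤ (t.card : ℝ≥0∞) := by
      have := ENat.toENNReal_mono ht.coverMincard_le_card
      simpa using this
    refine h2.trans ?_
    rw [← ENNReal.ofReal_natCast, ← ENNReal.ofReal_pow (inv_nonneg.2 h0.le),
      ← ENNReal.ofReal_mul hB0.le]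
    refine ENNReal.ofReal_le_ofReal ?_
    have h3 : t.card ≤ ∑ i, A * ∑ k ∈ Finset.range (n + 1), walkCount T x k i + (N + 1) :=
      (Finset.card_union_le _ _).trans (add_le_add
        (Finset.card_biUnion_le.trans (Finset.sum_le_sum fun i _ => s_card i))
        (Finset.card_image_le.trans (by simp)))
    have hone : 1 ≤ γ⁻¹ ^ (n + 1) := one_le_pow₀ ((one_le_inv₀ h0).2 h1.le)
    have h4 : ∀ i, ∑ k ∈ Finset.range (n + 1), (walkCount T x k i : ℝ) ≤
        C * (1 - γ)⁻¹ * γ⁻¹ ^ (n + 1) := by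
      intro i
      have h5 : ∀ k ∈ Finset.range (n + 1), (walkCount T x k i : ℝ) ≤
          C * γ⁻¹ ^ (n + 1) * γ ^ (n + 1 - 1 - k) := by
        intro k hk
        rw [Finset.mem_range] at hk
        have h6 : (walkCount T x k i : ℝ) ≤ C * γ⁻¹ ^ k := by
          rw [inv_pow, ← div_eq_mul_inv, le_div_iff₀ (pow_pos h0 k), mul_comm]
          exact hC k i
        refine h6.trans ?_
        rw [mul_assoc]
        refine mul_le_mul_of_nonneg_left ?_ hC0
        have e : γ⁻¹ ^ (n + 1) * γ ^ (n + 1 - 1 - k) = γ⁻¹ ^ (k + 1) := by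
          obtain ⟨d, rfl⟩ : ∃ d, n = k + d := ⟨n - k, by omega⟩
          rw [show k + d + 1 - 1 - k = d by omega, show k + d + 1 = (k + 1) + d by ring, pow_add,
            mul_assoc, ← mul_pow, inv_mul_cancel₀ h0.ne', one_pow, mul_one]
        rw [e]
        exact pow_le_pow_right₀ ((one_le_inv₀ h0).2 h1.le) (Nat.le_succ k)
      refine (Finset.sum_le_sum h5).trans ?_
      rw [← Finset.mul_sum, Finset.sum_range_reflect (fun k => γ ^ k) (n + 1)]
      have h7 : ∑ k ∈ Finset.range (n + 1), γ ^ k ≤ (1 - γ)⁻¹ := by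
        rw [← tsum_geometric_of_lt_one h0.le h1]
        exact (summable_geometric_of_lt_one h0.le h1).sum_le_tsum _ fun k _ => pow_nonneg h0.le k
      calc _ ≤ C * γ⁻¹ ^ (n + 1) * (1 - γ)⁻¹ := by gcongr
        _ = _ := by ring
    calc (t.card : ℝ) ≤ ∑ i, A * ∑ k ∈ Finset.range (n + 1), (walkCount T x k i : ℝ) + (N + 1) := by
          exact_mod_cast h3
      _ ≤ ∑ i : Fin N, A * (C * (1 - γ)⁻¹ * γ⁻¹ ^ (n + 1)) + (N + 1) * γ⁻¹ ^ (n + 1) := by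
          refine add_le_add (Finset.sum_le_sum fun i _ =>
            mul_le_mul_of_nonneg_left (h4 i) (Nat.cast_nonneg A)) ?_
          exact le_mul_of_one_le_right (by positivity) hone
      _ = _ := by
          rw [Finset.sum_const, Finset.card_univ, Fintype.card_fin, nsmul_eq_mul, hB]
          ring
  have hBne : ENNReal.ofReal B ≠ 0 := (ENNReal.ofReal_pos.2 hB0).ne'
  have hev : (fun n : ℕ => ((Dynamics.coverMincard T Set.univ U n : ℕ∞) : ℝ≥0∞)) ≤ᶠ[Filter.atTop]
      (fun _ : ℕ => ENNReal.ofReal B) * fun n : ℕ => ENNReal.ofReal γ⁻¹ ^ n := by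
    filter_upwards [Filter.eventually_ge_atTop 1] with n hn
    obtain ⟨n, rfl⟩ : ∃ k, n = k + 1 := ⟨n - 1, by omega⟩
    exact hcov n
  refine (ExpGrowth.expGrowthSup_eventually_monotone hev).trans ?_
  have hconst := ExpGrowth.expGrowthSup_const hBne (ENNReal.ofReal_ne_top (r := B))
  refine (ExpGrowth.expGrowthSup_mul_le (Or.inl ?_) (Or.inl ?_)).trans ?_
  · rw [hconst]; exact EReal.zero_ne_bot
  · rw [hconst]; exact EReal.zero_ne_top
  · rw [hconst, ExpGrowth.expGrowthSup_pow, zero_add]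

end IsAffineExpandingMarkov

/-! ### Itineraries: walk growth is at most the entropy -/

open scoped ENNReal Uniformity

/-- The set of indices of the atoms that contain `y`; it has at most one element. -/
def atomLabel {N : ℕ} (x : Fin (N + 1) → unitInterval) (y : unitInterval) : Set (Fin N) :=
  {i | y ∈ atom x i}

/-- The list of the labels of the first `n` points of the orbit of `y`. -/
def itinerary {N : ℕ} (T : unitInterval → unitInterval) (x : Fin (N + 1) → unitInterval) :
    ℕ → unitInterval → List (Set (Fin N))
  | 0, _ => []
  | n + 1, y => atomLabel x y :: itinerary T x n (T y)

open Classical in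
/-- The itineraries of length `n + 1` given by the walks with `n` steps from `i`. -/
noncomputable def walkWords {N : ℕ} (T : unitInterval → unitInterval)
    (x : Fin (N + 1) → unitInterval) : ℕ → Fin N → Finset (List (Set (Fin N)))
  | 0, i => {[{i}]}
  | n + 1, i => (successors T x i).biUnion fun j =>
      (walkWords T x n j).image fun w => ({i} : Set (Fin N)) :: w

theorem length_itinerary {N : ℕ} (T : unitInterval → unitInterval)
    (x : Fin (N + 1) → unitInterval) (n : ℕ) (y : unitInterval) :
    (itinerary T x n y).length = n := by
  induction n generalizing y with
  | zero => rfl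
  | succ n ih => simp [itinerary, ih]

theorem itinerary_add {N : ℕ} (T : unitInterval → unitInterval)
    (x : Fin (N + 1) → unitInterval) (m n : ℕ) (y : unitInterval) :
    itinerary T x (m + n) y = itinerary T x m y ++ itinerary T x n (T^[m] y) := by
  induction m generalizing y with
  | zero => simp [itinerary]
  | succ m ih =>
    rw [Nat.add_right_comm, itinerary, ih, itinerary, List.cons_append, Function.iterate_succ_apply]

theorem finite_itineraries {N : ℕ} (T : unitInterval → unitInterval)
    (x : Fin (N + 1) → unitInterval) (n : ℕ) : (Set.range (itinerary T x n)).Finite := by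
  refine (List.finite_length_eq (Set (Fin N)) n).subset ?_
  rintro _ ⟨y, rfl⟩
  exact length_itinerary T x n y

theorem head_of_mem_walkWords {N : ℕ} {T : unitInterval → unitInterval}
    {x : Fin (N + 1) → unitInterval} {n : ℕ} {i : Fin N} {w : List (Set (Fin N))}
    (hw : w ∈ walkWords T x n i) : w.head? = some {i} := by
  classical
  cases n with
  | zero => rw [walkWords, Finset.mem_singleton] at hw; simp [hw]
  | succ n =>
    simp only [walkWords, Finset.mem_biUnion, Finset.mem_image] at hw
    obtain ⟨j, -, v, -, rfl⟩ := hw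
    rfl

theorem disjoint_walkWords {N : ℕ} {T : unitInterval → unitInterval}
    {x : Fin (N + 1) → unitInterval} {n : ℕ} {i j : Fin N} (hij : i ≠ j) :
    Disjoint (walkWords T x n i) (walkWords T x n j) := by
  rw [Finset.disjoint_left]
  intro w hi hj
  have h := (head_of_mem_walkWords hi).symm.trans (head_of_mem_walkWords hj)
  exact hij (Set.singleton_injective (Option.some_injective _ h))

theorem card_walkWords {N : ℕ} (T : unitInterval → unitInterval)
    (x : Fin (N + 1) → unitInterval) (n : ℕ) (i : Fin N) :
    (walkWords T x n i).card = walkCount T x n i := by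
  classical
  induction n generalizing i with
  | zero => simp [walkWords, walkCount]
  | succ n ih =>
    rw [walkWords, walkCount, Finset.card_biUnion]
    · refine Finset.sum_congr rfl fun j _ => ?_
      rw [Finset.card_image_of_injective _ (List.cons_injective), ih]
    · intro j _ k _ hjk
      exact (Finset.disjoint_image List.cons_injective).2 (disjoint_walkWords hjk)

namespace IsAffineExpandingMarkov

variable {N : ℕ} {T : unitInterval → unitInterval} {x : Fin (N + 1) → unitInterval}

theorem atomLabel_eq (hT : IsAffineExpandingMarkov T x) {y : unitInterval} {i : Fin N}
    (hy : y ∈ atom x i) : atomLabel x y = {i} := by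
  ext j
  exact ⟨fun hj => mem_atom_unique hT.strictMono hj hy, fun hj => by
    rw [Set.mem_singleton_iff] at hj; subst hj; exact hy⟩

/-- The image of an atom contains each successor entirely, so a regular point can be pulled back
along the whole walk. -/
theorem exists_itinerary_eq (hT : IsAffineExpandingMarkov T x) {n : ℕ} {i : Fin N}
    {w : List (Set (Fin N))} (hw : w ∈ walkWords T x n i) :
    ∃ y ∈ regularPoints T x, y ∈ atom x i ∧ itinerary T x (n + 1) y = w := by
  classical
  induction n generalizing i w with
  | zero =>
    rw [walkWords, Finset.mem_singleton] at hw
    obtain ⟨y, -, hy, -, hyi, -⟩ := hT.exists_pair_regularPoints i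
    exact ⟨y, hy, hyi, by simp [itinerary, hT.atomLabel_eq hyi, hw]⟩
  | succ n ih =>
    simp only [walkWords, Finset.mem_biUnion, Finset.mem_image] at hw
    obtain ⟨j, hj, v, hv, rfl⟩ := hw
    obtain ⟨z, hz, hzj, hzv⟩ := ih hv
    obtain ⟨y, hy, rfl⟩ := exists_preimage hj hzj
    exact ⟨y, hT.mem_regularPoints_of_apply hy hz, hy, by
      rw [itinerary, hzv, hT.atomLabel_eq hy]⟩

theorem sum_walkCount_le_card (hT : IsAffineExpandingMarkov T x) {n : ℕ}
    {F : Finset (List (Set (Fin N)))}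
    (hF : ∀ y ∈ regularPoints T x, itinerary T x (n + 1) y ∈ F) :
    ∑ i, walkCount T x n i ≤ F.card := by
  classical
  have h1 : Finset.univ.biUnion (walkWords T x n) ⊆ F := by
    intro w hw
    obtain ⟨i, -, hi⟩ := Finset.mem_biUnion.1 hw
    obtain ⟨y, hy, -, rfl⟩ := hT.exists_itinerary_eq hi
    exact hF y hy
  refine le_trans (le_of_eq ?_) (Finset.card_le_card h1)
  rw [Finset.card_biUnion fun i _ j _ hij => disjoint_walkWords hij]
  exact Finset.sum_congr rfl fun i _ => (card_walkWords T x n i).symm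

/-- Cylinders have positive diameter; this gives the scale `ε` in `exists_itineraries_ball`. -/
theorem exists_ne_itinerary_eq (hT : IsAffineExpandingMarkov T x) (n : ℕ) {i : Fin N}
    {y : unitInterval} (hy : y ∈ regularPoints T x) (hyi : y ∈ atom x i) :
    ∃ z ∈ regularPoints T x, z ∈ atom x i ∧ z ≠ y ∧ itinerary T x n z = itinerary T x n y := by
  induction n generalizing i y with
  | zero =>
    obtain ⟨p, q, hp, hq, hpi, hqi, hpq⟩ := hT.exists_pair_regularPoints i
    by_cases h : p = y
    · exact ⟨q, hq, hqi, fun h' => hpq (h.trans h'.symm), rfl⟩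
    · exact ⟨p, hp, hpi, h, rfl⟩
  | succ n ih =>
    obtain ⟨j, hj, hyj⟩ := (hT.apply_mem hyi).resolve_left (hy 1)
    obtain ⟨z', hz', hzj, hne, hit⟩ := ih (regularPoints_apply hy) hyj
    obtain ⟨z, hz, rfl⟩ := exists_preimage hj hzj
    refine ⟨z, hT.mem_regularPoints_of_apply hz hz', hz, fun h => hne (by rw [h]), ?_⟩
    rw [itinerary, itinerary, hit, hT.atomLabel_eq hz, hT.atomLabel_eq hyi]

/-- Cylinders are order-convex because `T` is monotone or antitone on each atom. The induction
treats both orders of the end points, since a branch may reverse them. -/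
theorem itinerary_eq_of_between (hT : IsAffineExpandingMarkov T x) (n : ℕ) {y z w : unitInterval}
    (hy : y ∈ regularPoints T x) (hyz : y ≤ z) (hzw : z ≤ w)
    (h : itinerary T x n y = itinerary T x n w) : itinerary T x n z = itinerary T x n y := by
  have key : ∀ n (y z w : unitInterval), y ∈ regularPoints T x →
      (y ≤ z ∧ z ≤ w ∨ w ≤ z ∧ z ≤ y) → itinerary T x n y = itinerary T x n w →
      itinerary T x n z = itinerary T x n y := by
    intro n
    induction n with
    | zero => intros; rfl
    | succ n ih =>
      intro y z w hy hz h
      rw [itinerary, itinerary, List.cons_eq_cons] at h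
      obtain ⟨i, hi⟩ := hT.exists_mem_atom_of_regular hy
      have hw : w ∈ atom x i := by
        have : i ∈ atomLabel x w := h.1 ▸ hi
        exact this
      have hzi : z ∈ atom x i := by
        rcases hz with hz | hz
        · exact ⟨hi.1.trans_le hz.1, hz.2.trans_lt hw.2⟩
        · exact ⟨hw.1.trans_le hz.1, hz.2.trans_lt hi.2⟩
      rw [itinerary, itinerary, hT.atomLabel_eq hzi, hT.atomLabel_eq hi,
        ih (T y) (T z) (T w) (regularPoints_apply hy) ?_ h.2]
      rcases hT.monotoneOn_or_antitoneOn i with hm | hm <;> rcases hz with hz | hz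
      · exact Or.inl ⟨hm hi hzi hz.1, hm hzi hw hz.2⟩
      · exact Or.inr ⟨hm hw hzi hz.1, hm hzi hi hz.2⟩
      · exact Or.inr ⟨hm hzi hw hz.2, hm hi hzi hz.1⟩
      · exact Or.inl ⟨hm hzi hi hz.2, hm hw hzi hz.1⟩
  exact key n y z w hy (Or.inl ⟨hyz, hzw⟩) h

/-- A small ball meets at most two cylinders of a given rank. -/
theorem exists_itineraries_ball (hT : IsAffineExpandingMarkov T x) (m : ℕ) :
    ∃ ε : ℝ, 0 < ε ∧ ∀ c : unitInterval, ∃ V : Finset (List (Set (Fin N))), V.card ≤ 2 ∧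
      ∀ y ∈ regularPoints T x, dist y c < ε → itinerary T x m y ∈ V := by
  classical
  -- There are finitely many words, so one `ε` works for all: every cylinder with a regular point
  -- has two regular points more than `2 * ε` apart.
  have hsep : ∀ᶠ ε : ℝ in nhdsWithin 0 (Set.Ioi 0), ∀ w ∈ Set.range (itinerary T x m),
      ∀ y ∈ regularPoints T x, itinerary T x m y = w →
      ∃ p ∈ regularPoints T x, ∃ q ∈ regularPoints T x, itinerary T x m p = w ∧
        itinerary T x m q = w ∧ 2 * ε < dist p q := by
    rw [Filter.eventually_all_finite (finite_itineraries T x m)]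
    intro w _
    by_cases hw : ∃ y ∈ regularPoints T x, itinerary T x m y = w
    · obtain ⟨y, hy, rfl⟩ := hw
      obtain ⟨i, hi⟩ := hT.exists_mem_atom_of_regular hy
      obtain ⟨z, hz, -, hne, hit⟩ := hT.exists_ne_itinerary_eq m hy hi
      have hd : 0 < dist z y / 2 := half_pos (dist_pos.2 hne)
      filter_upwards [Ioo_mem_nhdsGT hd] with ε hε _ _ _
      exact ⟨z, hz, y, hy, hit, rfl, by linarith [hε.2]⟩
    · exact Filter.Eventually.of_forall fun ε y hy h => absurd ⟨y, hy, h⟩ hw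
  obtain ⟨ε, hε, hpos⟩ := (hsep.and self_mem_nhdsWithin).exists
  have hpos' : 0 < ε := hpos
  refine ⟨ε, hpos', fun c => ?_⟩
  -- With three cylinders in the ball, the regular points of the middle one would lie between two
  -- points of the ball, hence within `2 * ε` of each other.
  have key : ∀ y₁ ∈ regularPoints T x, ∀ y₂ ∈ regularPoints T x, ∀ y₃ ∈ regularPoints T x,
      dist y₁ c < ε → dist y₃ c < ε → y₁ < y₂ → y₂ < y₃ →
      itinerary T x m y₁ ≠ itinerary T x m y₂ → itinerary T x m y₂ ≠ itinerary T x m y₃ → False := by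
    intro y₁ h₁ y₂ h₂ y₃ h₃ d₁ d₃ h12 h23 n12 n23
    obtain ⟨p, hp, q, hq, ep, eq, hd⟩ := hε _ ⟨y₂, rfl⟩ y₂ h₂ rfl
    have inside : ∀ r ∈ regularPoints T x, itinerary T x m r = itinerary T x m y₂ →
        y₁ < r ∧ r < y₃ := by
      intro r hr er
      constructor
      · by_contra! hle
        exact n12 ((hT.itinerary_eq_of_between m hr hle h12.le er).trans er)
      · by_contra! hle
        exact n23 (hT.itinerary_eq_of_between m h₂ h23.le hle er.symm).symm
    obtain ⟨p1, p3⟩ := inside p hp ep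
    obtain ⟨q1, q3⟩ := inside q hq eq
    rw [Subtype.dist_eq, Real.dist_eq] at hd d₁ d₃
    rw [← Subtype.coe_lt_coe] at p1 p3 q1 q3
    rw [abs_lt] at d₁ d₃
    have : |(p : ℝ) - q| < 2 * ε := by
      rw [abs_lt]; constructor <;> linarith
    linarith
  have hfin : {w | ∃ y ∈ regularPoints T x, dist y c < ε ∧ itinerary T x m y = w}.Finite :=
    (finite_itineraries T x m).subset (by rintro _ ⟨y, -, -, rfl⟩; exact ⟨y, rfl⟩)
  refine ⟨hfin.toFinset, ?_, fun y hy hd => hfin.mem_toFinset.2 ⟨y, hy, hd, rfl⟩⟩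
  by_contra! hcard
  obtain ⟨a, ha, b, hb, c', hc, hab, hac, hbc⟩ := Finset.two_lt_card.1 hcard
  obtain ⟨ya, ga, da, rfl⟩ := hfin.mem_toFinset.1 ha
  obtain ⟨yb, gb, db, rfl⟩ := hfin.mem_toFinset.1 hb
  obtain ⟨yc, gc, dc, rfl⟩ := hfin.mem_toFinset.1 hc
  have nab : ya ≠ yb := fun h => hab (by rw [h])
  have nac : ya ≠ yc := fun h => hac (by rw [h])
  have nbc : yb ≠ yc := fun h => hbc (by rw [h])
  rcases lt_or_gt_of_ne nab with h1 | h1 <;> rcases lt_or_gt_of_ne nbc with h2 | h2 <;>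
    rcases lt_or_gt_of_ne nac with h3 | h3
  · exact key ya ga yb gb yc gc da dc h1 h2 hab hbc
  · exact key ya ga yb gb yc gc da dc h1 h2 hab hbc
  · exact key ya ga yc gc yb gb da db h3 h2 hac hbc.symm
  · exact key yc gc ya ga yb gb dc db h3 h1 hac.symm hab
  · exact key yb gb ya ga yc gc db dc h1 h3 hab.symm hac
  · exact key yb gb yc gc ya ga db da h2 h3 hbc hac.symm
  · exact key yc gc yb gb ya ga dc da h2 h1 hbc.symm hab.symm
  · exact key yc gc yb gb ya ga dc da h2 h1 hbc.symm hab.symm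

/-- Cut the orbit into `n` blocks of length `m`; each block leaves at most two choices. -/
theorem exists_itineraries_dynamical_ball {m : ℕ} (hm : 1 ≤ m) {ε : ℝ}
    (hε : ∀ c : unitInterval, ∃ V : Finset (List (Set (Fin N))), V.card ≤ 2 ∧
      ∀ y ∈ regularPoints T x, dist y c < ε → itinerary T x m y ∈ V) (n : ℕ) (c : unitInterval) :
    ∃ V : Finset (List (Set (Fin N))), V.card ≤ 2 ^ n ∧ ∀ y ∈ regularPoints T x,
      (∀ k < m * n, dist (T^[k] y) (T^[k] c) < ε) → itinerary T x (m * n) y ∈ V := by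
  classical
  induction n generalizing c with
  | zero => exact ⟨{[]}, by simp, fun y _ _ => by simp [itinerary]⟩
  | succ n ih =>
    obtain ⟨V, hV, hV'⟩ := hε c
    obtain ⟨V₁, hV₁, hV₁'⟩ := ih (T^[m] c)
    refine ⟨Finset.image₂ (· ++ ·) V V₁, ?_, fun y hy hd => ?_⟩
    · refine (Finset.card_image₂_le _ _ _).trans ?_
      rw [pow_succ, mul_comm]
      exact Nat.mul_le_mul hV₁ hV
    · rw [Nat.mul_succ, Nat.add_comm, itinerary_add]
      refine Finset.mem_image₂_of_mem (hV' y hy (hd 0 ?_))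
        (hV₁' _ (regularPoints_iterate hy m) fun k hk => ?_)
      · rw [Nat.mul_succ]; omega
      · rw [← Function.iterate_add_apply, ← Function.iterate_add_apply]
        exact hd (k + m) (by rw [Nat.mul_succ]; omega)

theorem sum_walkCount_le_cover (hT : IsAffineExpandingMarkov T x) {m : ℕ} (hm : 1 ≤ m) {ε : ℝ}
    (hε : ∀ c : unitInterval, ∃ V : Finset (List (Set (Fin N))), V.card ≤ 2 ∧
      ∀ y ∈ regularPoints T x, dist y c < ε → itinerary T x m y ∈ V) {n l : ℕ} (hl : l + 1 ≤ m * n)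
    {s : Finset unitInterval}
    (hs : Dynamics.IsDynCoverOf T Set.univ {p : unitInterval × unitInterval | dist p.1 p.2 < ε}
      (m * n) (s : Set unitInterval)) :
    ∑ i, walkCount T x l i ≤ s.card * 2 ^ n := by
  classical
  obtain ⟨k, hk⟩ : ∃ k, m * n = k + 1 := ⟨m * n - 1, by omega⟩
  choose V hV hV' using exists_itineraries_dynamical_ball hm hε n
  have h1 : ∑ i, walkCount T x k i ≤ (s.biUnion V).card := by
    refine hT.sum_walkCount_le_card fun y hy => ?_
    obtain ⟨z, hz, hyz⟩ := hs (Set.mem_univ y)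
    rw [← hk]
    exact Finset.mem_biUnion.2 ⟨z, hz, hV' z y hy (Dynamics.mem_dynEntourage.1 hyz)⟩
  calc ∑ i, walkCount T x l i ≤ ∑ i, walkCount T x k i :=
        Finset.sum_le_sum fun i _ => hT.walkCount_mono i (by omega)
    _ ≤ ∑ z ∈ s, (V z).card := h1.trans Finset.card_biUnion_le
    _ ≤ s.card * 2 ^ n := (Finset.sum_le_card_nsmul _ _ _ fun z _ => hV z).trans (by simp)

theorem walkCount_le_of_topEntropy_lt (hT : IsAffineExpandingMarkov T x) {γ : ℝ} (h0 : 0 < γ)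
    (h1 : γ < 1) (h : EReal.exp (topEntropy T) * ENNReal.ofReal γ < 1) :
    ∃ C ρ : ℝ, 0 < ρ ∧ ρ * γ < 1 ∧ ∀ n, ((∑ i, walkCount T x n i : ℕ) : ℝ) ≤ C * ρ ^ n := by
  have hγ : ENNReal.ofReal γ ≠ 0 := (ENNReal.ofReal_pos.2 h0).ne'
  have h2 : EReal.exp (topEntropy T) < ENNReal.ofReal γ⁻¹ := by
    rw [ENNReal.ofReal_inv_of_pos h0, ← one_div]
    exact (ENNReal.lt_div_iff_mul_lt (Or.inl hγ) (Or.inl ENNReal.ofReal_ne_top)).2 h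
  obtain ⟨r, hr, hrγ⟩ := ENNReal.lt_iff_exists_nnreal_btwn.1 h2
  have hr0 : (0 : ℝ) < r := by
    rcases eq_or_ne r 0 with rfl | hne
    · simp at hr
    · exact NNReal.coe_pos.2 (pos_iff_ne_zero.2 hne)
  have hrγ' : (r : ℝ) < γ⁻¹ := by
    rw [← ENNReal.ofReal_coe_nnreal, ENNReal.ofReal_lt_ofReal_iff (inv_pos.2 h0)] at hrγ
    exact hrγ
  obtain ⟨ρ, hρ, hργ⟩ := exists_between (max_lt hrγ' ((one_lt_inv₀ h0).2 h1))
  have hrρ : (r : ℝ) < ρ := (le_max_left _ _).trans_lt hρ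
  have hρ1 : 1 < ρ := (le_max_right _ _).trans_lt hρ
  have hρ0 : 0 < ρ := zero_lt_one.trans hρ1
  -- Blocks are taken so long that the factor 2 lost in each is absorbed by passing from `r` to `ρ`.
  obtain ⟨m, hm⟩ := exists_pow_lt_of_lt_one (show (0 : ℝ) < 1 / 2 by norm_num)
    ((div_lt_one hρ0).2 hrρ)
  have hm1 : 1 ≤ m := by
    by_contra! h
    obtain rfl : m = 0 := by omega
    norm_num at hm
  have hm2 : 2 * (r : ℝ) ^ m ≤ ρ ^ m := by
    rw [div_pow, div_lt_iff₀ (pow_pos hρ0 m)] at hm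
    linarith
  obtain ⟨ε, hε, hball⟩ := hT.exists_itineraries_ball m
  have hU : {p : unitInterval × unitInterval | dist p.1 p.2 < ε} ∈ 𝓤 unitInterval :=
    Metric.dist_mem_uniformity hε
  have h3 : Dynamics.coverEntropyEntourage T Set.univ
      {p : unitInterval × unitInterval | dist p.1 p.2 < ε} < ENNReal.log r := by
    refine (Dynamics.coverEntropyEntourage_le_coverEntropy T Set.univ hU).trans_lt ?_
    rw [← EReal.log_exp (Dynamics.coverEntropy T Set.univ)]
    exact ENNReal.log_strictMono hr
  obtain ⟨n₀, hn₀⟩ := Filter.eventually_atTop.1 (ExpGrowth.eventually_le_exp h3)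
  have hcov : ∀ n ≥ n₀, ∃ s : Finset unitInterval, Dynamics.IsDynCoverOf T Set.univ
      {p : unitInterval × unitInterval | dist p.1 p.2 < ε} n (s : Set unitInterval) ∧
      (s.card : ℝ) ≤ (r : ℝ) ^ n := by
    intro n hn
    have h4 := hn₀ n hn
    rw [mul_comm, EReal.exp_nmul, ENNReal.exp_log] at h4
    have h5 : Dynamics.coverMincard T Set.univ
        {p : unitInterval × unitInterval | dist p.1 p.2 < ε} n < ⊤ := by
      rw [← ENat.toENNReal_lt, ENat.toENNReal_top]
      exact h4.trans_lt (by rw [← ENNReal.coe_pow]; exact ENNReal.coe_lt_top)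
    obtain ⟨s, hs, hcard⟩ := (Dynamics.coverMincard_finite_iff T Set.univ _ n).1 h5
    refine ⟨s, hs, ?_⟩
    rw [← hcard, ← ENNReal.coe_pow, ENat.toENNReal_coe] at h4
    have h6 : ((s.card : NNReal) : ℝ≥0∞) ≤ ((r ^ n : NNReal) : ℝ≥0∞) := by simpa using h4
    have h7 := ENNReal.coe_le_coe.1 h6
    exact_mod_cast h7
  refine ⟨ρ ^ (m + m * n₀), ρ, hρ0, ?_, fun l => ?_⟩
  · calc ρ * γ < γ⁻¹ * γ := by gcongr
      _ = 1 := inv_mul_cancel₀ h0.ne'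
  -- Enough blocks that `m * n` exceeds `l` and is at least `n₀`, yet `m * n ≤ m + m * n₀ + l`;
  -- hence the constant `ρ ^ (m + m * n₀)`.
  · set n := l / m + 1 + n₀ with hn
    have e1 : m * n = m * (l / m) + m + m * n₀ := by rw [hn]; ring
    have e2 := Nat.div_add_mod l m
    have e3 := Nat.mod_lt l hm1
    have e4 : n₀ ≤ m * n₀ := Nat.le_mul_of_pos_left _ hm1
    obtain ⟨s, hs, hcard⟩ := hcov (m * n) (by omega)
    have h4 := hT.sum_walkCount_le_cover hm1 hball (l := l) (by omega) hs
    calc ((∑ i, walkCount T x l i : ℕ) : ℝ) ≤ s.card * 2 ^ n := by exact_mod_cast h4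
      _ ≤ (r : ℝ) ^ (m * n) * 2 ^ n := by gcongr
      _ = (2 * (r : ℝ) ^ m) ^ n := by rw [pow_mul, mul_pow, mul_comm]
      _ ≤ (ρ ^ m) ^ n := pow_le_pow_left₀ (by positivity) hm2 n
      _ = ρ ^ (m * n) := by rw [pow_mul]
      _ ≤ ρ ^ (m + m * n₀ + l) := pow_le_pow_right₀ hρ1.le (by omega)
      _ = _ := by rw [pow_add]

end IsAffineExpandingMarkov

/-! ### Closed walks and the exceptional parameters -/

/-- A function `f` that follows the edges of the transition graph and returns from `i` to `i` after
`L` steps, with `1 ≤ L ≤ N`. -/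
structure IsShortClosedWalk {N : ℕ} (S : Fin N → Finset (Fin N)) (i : Fin N) (f : Fin N → Fin N)
    (L : ℕ) : Prop where
  mem : ∀ k, f k ∈ S k
  one_le : 1 ≤ L
  le : L ≤ N
  closed : f^[L] i = i

theorem IsShortClosedWalk.periodic {N : ℕ} {S : Fin N → Finset (Fin N)} {i : Fin N}
    {f : Fin N → Fin N} {L : ℕ} (h : IsShortClosedWalk S i f L) {α : Type*} (u : Fin N → α) :
    Function.Periodic (fun k => u (f^[k] i)) L := fun k => by
  simp only [Function.iterate_add_apply, h.closed]

theorem IsShortClosedWalk.apply {N : ℕ} {S : Fin N → Finset (Fin N)} {i : Fin N}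
    {f : Fin N → Fin N} {L : ℕ} (h : IsShortClosedWalk S i f L) :
    IsShortClosedWalk S (f i) f L where
  mem := h.mem
  one_le := h.one_le
  le := h.le
  closed := by rw [← Function.iterate_succ_apply, Function.iterate_succ_apply', h.closed]

namespace IsAffineExpandingMarkov

variable {N : ℕ} {T : unitInterval → unitInterval} {x : Fin (N + 1) → unitInterval}

theorem exists_shortClosedWalk (hirr : (transitionMatrix T x).IsIrreducible) {i j : Fin N}
    (hj : j ∈ successors T x i) :
    ∃ f L, IsShortClosedWalk (successors T x) i f L ∧ f i = j := by
  obtain ⟨f, hf, hij, L, hL, hLN, hper⟩ := exists_periodic_selection (reachable hirr) hj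
  exact ⟨f, L, ⟨hf, hL, hLN, hper⟩, hij⟩

/-- The closed walks from some atom do not all have the same slopes and translations. -/
theorem exists_distinct_closedWalks (hT : IsAffineExpandingMarkov T x)
    (hirr : (transitionMatrix T x).IsIrreducible) :
    ∃ i f f' L L', IsShortClosedWalk (successors T x) i f L ∧
      IsShortClosedWalk (successors T x) i f' L' ∧
      ¬ ((fun k => hT.slope (f^[k] i)) = (fun k => hT.slope (f'^[k] i)) ∧
        (fun k => hT.translation (f^[k] i)) = (fun k => hT.translation (f'^[k] i))) := by
  by_contra! hcon
  have hex : ∀ i, ∃ f L, IsShortClosedWalk (successors T x) i f L := fun i => by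
    obtain ⟨j, hj⟩ := hT.successors_nonempty i
    obtain ⟨f, L, h, -⟩ := exists_shortClosedWalk hirr hj
    exact ⟨f, L, h⟩
  choose F P hF using hex
  let s : Fin N → ℕ → ℝ := fun i k => hT.slope ((F i)^[k] i)
  let t : Fin N → ℕ → ℝ := fun i k => hT.translation ((F i)^[k] i)
  -- The edge from `i` to `j` lies on a short closed walk, and that walk rotated by one step is a
  -- closed walk from `j`. If the data depend only on the starting atom, those of `j` are those of
  -- `i` shifted.
  have hshift : ∀ i, ∀ j ∈ successors T x i, ∀ k, s j k = s i (k + 1) ∧ t j k = t i (k + 1) := by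
    intro i j hj k
    obtain ⟨f, L, hf, rfl⟩ := exists_shortClosedWalk hirr hj
    obtain ⟨h1, h2⟩ := hcon i (F i) f (P i) L (hF i) hf
    obtain ⟨h3, h4⟩ := hcon (f i) (F (f i)) f (P (f i)) L (hF (f i)) hf.apply
    exact ⟨(congrFun h3 k).trans (congrFun h1 (k + 1)).symm,
      (congrFun h4 k).trans (congrFun h2 (k + 1)).symm⟩
  -- The constant depends on the data sequences alone, not on the atom, so different successors of
  -- `i` yield the same affine formula.
  have hiter : ∀ n, ∀ σ τ : ℕ → ℝ, ∃ c : ℝ, ∀ i, s i = σ → t i = τ →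
      ∀ y ∈ regularPoints T x, y ∈ atom x i →
        (T^[n] y : ℝ) = (∏ k ∈ Finset.range n, σ k) * y + c := by
    intro n
    induction n with
    | zero => exact fun σ τ => ⟨0, fun i _ _ y _ _ => by simp⟩
    | succ n ih =>
      intro σ τ
      obtain ⟨c, hc⟩ := ih (fun k => σ (k + 1)) (fun k => τ (k + 1))
      refine ⟨(∏ k ∈ Finset.range n, σ (k + 1)) * τ 0 + c, ?_⟩
      rintro i rfl rfl y hy hyi
      obtain ⟨j, hj, hyj⟩ := (hT.apply_mem hyi).resolve_left (hy 1)
      rw [Function.iterate_succ_apply, hc j (funext fun k => (hshift i j hj k).1)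
        (funext fun k => (hshift i j hj k).2) _ (regularPoints_apply hy) hyj, hT.apply_eq hyi,
        Finset.prod_range_succ' _ n]
      simp only [s, t, Function.iterate_zero, id_eq]
      ring
  have : Nonempty (Fin N) := ⟨⟨0, hT.pos⟩⟩
  -- On the regular points of this atom `T^[n]` is one affine map of slope at least `|hT.slope i₀| ^
  -- n` in modulus, impossible for large `n` since its values lie in `[0, 1]`.
  obtain ⟨i₀, hi₀⟩ := Finite.exists_min fun i => |hT.slope i|
  obtain ⟨p, q, hp, hq, hpi, hqi, hpq⟩ := hT.exists_pair_regularPoints i₀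
  have hd : 0 < |(p : ℝ) - q| := abs_pos.2 fun h => hpq (Subtype.ext (by linarith))
  obtain ⟨n, hn⟩ := pow_unbounded_of_one_lt (|(p : ℝ) - q|⁻¹) (hT.one_lt_abs_slope i₀)
  obtain ⟨c, hc⟩ := hiter n (s i₀) (t i₀)
  have e : (T^[n] p : ℝ) - T^[n] q = (∏ k ∈ Finset.range n, s i₀ k) * (p - q) := by
    rw [hc i₀ rfl rfl p hp hpi, hc i₀ rfl rfl q hq hqi]; ring
  have h1 : |hT.slope i₀| ^ n ≤ |∏ k ∈ Finset.range n, s i₀ k| := by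
    rw [Finset.abs_prod]
    calc |hT.slope i₀| ^ n = ∏ _k ∈ Finset.range n, |hT.slope i₀| := by simp
      _ ≤ _ := Finset.prod_le_prod (fun _ _ => abs_nonneg _) fun k _ => hi₀ _
  have h2 : |(T^[n] p : ℝ) - T^[n] q| ≤ 1 := by
    have a1 := (T^[n] p).2
    have a2 := (T^[n] q).2
    rw [abs_le]; constructor <;> linarith [a1.1, a1.2, a2.1, a2.2]
  rw [e, abs_mul] at h2
  have h3 : 1 < |hT.slope i₀| ^ n * |(p : ℝ) - q| := by
    rwa [inv_lt_iff_one_lt_mul₀ hd] at hn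
  exact absurd (h3.trans_le ((mul_le_mul_of_nonneg_right h1 hd.le).trans h2)) (lt_irrefl _)

theorem isAffineSolution_of_affine (hT : IsAffineExpandingMarkov T x) {γ : ℝ} (h0 : 0 < γ)
    (h1 : γ < 1) {α β : Fin N → ℝ} (h : ∀ i, ∀ y ∈ atom x i, syncFun T γ y = α i * y + β i)
    {f : Fin N → Fin N} (hf : ∀ k, f k ∈ successors T x k) (i : Fin N) :
    IsAffineSolution γ (fun k => hT.slope (f^[k] i)) (fun k => hT.translation (f^[k] i))
      (fun k => α (f^[k] i)) (fun k => β (f^[k] i)) where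
  slope k := by
    simp only [Function.iterate_succ_apply']
    exact (hT.affine_relations h0 h1 h (hf _)).1
  trans k := by
    simp only [Function.iterate_succ_apply']
    exact (hT.affine_relations h0 h1 h (hf _)).2

open Polynomial in
/-- A nonzero polynomial of degree at most `2 * N - 1` vanishes at every parameter `γ` in `(0, 1)` for
which `syncFun T γ` is affine on each atom. -/
theorem exists_polynomial_of_affine (hT : IsAffineExpandingMarkov T x)
    (hirr : (transitionMatrix T x).IsIrreducible) :
    ∃ Q : ℝ[X], Q ≠ 0 ∧ Q.natDegree ≤ 2 * N - 1 ∧ ∀ γ : ℝ, 0 < γ → γ < 1 →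
      (∃ α β : Fin N → ℝ, ∀ i, ∀ y ∈ atom x i, syncFun T γ y = α i * y + β i) → Q.eval γ = 0 := by
  obtain ⟨i, f, f', L, L', hf, hf', hne⟩ := hT.exists_distinct_closedWalks hirr
  by_cases hσ : (fun k => hT.slope (f^[k] i)) = fun k => hT.slope (f'^[k] i)
  · have hτ := fun h => hne ⟨hσ, h⟩
    obtain ⟨Q, hQ, hdeg, hroot⟩ := exists_polynomial_of_trans_ne hf.one_le hf'.one_le hf.le hf'.le
      (fun k => hT.slope_ne_zero (f^[k] i)) (hf.periodic _) (hσ ▸ hf'.periodic _) (hf.periodic _)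
      (hf'.periodic _) hτ
    refine ⟨Q, hQ, hdeg, fun γ h0 h1 ⟨α, β, h⟩ => ?_⟩
    exact hroot γ _ _ _ _ h0 h1 (hT.isAffineSolution_of_affine h0 h1 h hf.mem i)
      (hσ ▸ hT.isAffineSolution_of_affine h0 h1 h hf'.mem i) (hf.periodic _) (hf'.periodic _)
      (by simp [hf.closed]) (by simp [hf'.closed]) rfl rfl
  · obtain ⟨Q, hQ, hdeg, hroot⟩ := exists_polynomial_of_slope_ne hf.one_le hf'.one_le hf.le hf'.le
      (τ := fun k => hT.translation (f^[k] i)) (τ' := fun k => hT.translation (f'^[k] i))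
      (fun k => hT.slope_ne_zero (f^[k] i)) (fun k => hT.slope_ne_zero (f'^[k] i)) (hf.periodic _)
      (hf'.periodic _) hσ
    refine ⟨Q, hQ, hdeg, fun γ h0 h1 ⟨α, β, h⟩ => ?_⟩
    exact hroot γ _ _ _ _ (hT.isAffineSolution_of_affine h0 h1 h hf.mem i)
      (hT.isAffineSolution_of_affine h0 h1 h hf'.mem i) (hf.periodic _) (hf'.periodic _) rfl

end IsAffineExpandingMarkov

theorem theorem1 (N : ℕ) (T : unitInterval → unitInterval) (x : Fin (N + 1) → unitInterval)
    (hT : IsAffineExpandingMarkov T x) (hirr : (transitionMatrix T x).IsIrreducible) :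
    (∀ γ : ℝ, 0 < γ → γ < 1 → EReal.exp (topEntropy T) * ENNReal.ofReal γ < 1 →
      eVariationOn (syncFun T γ) Set.univ < ⊤) ∧
    ∃ E : Finset ℝ, E.card ≤ 2 * N - 1 ∧
      ∀ γ : ℝ, 0 < γ → γ < 1 → 1 < EReal.exp (topEntropy T) * ENNReal.ofReal γ → γ ∉ E →
        eVariationOn (syncFun T γ) Set.univ = ⊤ := by
  refine ⟨fun γ h0 h1 h => ?_, ?_⟩
  · obtain ⟨C, ρ, hρ, hργ, hC⟩ := hT.walkCount_le_of_topEntropy_lt h0 h1 h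
    exact hT.eVariationOn_syncFun_lt_top h0 h1 hρ hργ hC
  · obtain ⟨Q, hQ, hdeg, hroot⟩ := hT.exists_polynomial_of_affine hirr
    refine ⟨Q.roots.toFinset, ?_, fun γ h0 h1 h hE => ?_⟩
    · exact (Multiset.toFinset_card_le _).trans ((Polynomial.card_roots' Q).trans hdeg)
    · by_contra hfin
      rcases hT.walkCount_bounded_or_affine hirr h0 h1 hfin with ⟨C, hC⟩ | haff
      · exact absurd (hT.exp_topEntropy_mul_le_one h0 h1 hC) (not_le.2 h)
      · refine hE (Multiset.mem_toFinset.2 ((Polynomial.mem_roots hQ).2 ?_))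
        exact hroot γ h0 h1 haff
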